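/- Let $V$ be a finite set and let $G,G'$ be simple graphs on $V$. For $A,B,C,D\subseteq V$ consider (i) for all $u,v\in V$: $|B\cap N_G(u)\cap N_{G'}(v)|+|A\cap N_G(u)\cap\{v\}|+|D\cap\{u\}\cap N_{G'}(v)|+|C\cap\{u\}\cap\{v\}|\equiv 0 \pmod 2$; (ii) $(A\cap D)\,\Delta\,(B\cap C)=V$. Identify a quadruple $(A,B,C,D)$ with its indicator vector in $\mathbb F_2^{4V}$. A linear constraint is an equation $\sum_{v\in V}(\alpha_v a_v+\beta_v b_v+\gamma_v c_v+\delta_v d_v)=0$ over $\mathbb F_2$. For a set $L$ of linear constraints, let $\mathcal S_L$ be the $\mathbb F_2$-vector space of the solutions of (i) and $L$, and let $\mathcal C_L\subseteq\mathcal S_L$ be the set of those that also satisfy (ii). 1. If $G$ and $G'$ are connected and each has a vertex of even degree, then for every set $L$ of linear constraints, either $\dim\mathcal S_L\le 4$, or $\mathcal C_L$ is empty or an affine subspace of $\mathcal S_L$ of codimension at most $2$. 2. Two arbitrary graphs $G,G'$ on $V$ are LC-equivalent, i.e. $G'=G\star a_1\star\cdots\star a_m$ for some sequence of (possibly repeating)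 vertices, where $\star\, a$ denotes local complementation at $a$, if and only if there are $A,B,C,D\subseteq V$ that satisfy (i) and (ii). (Accordingly, $G$ and $G'$ are called LC-equivalent under the constraints $L$ if $\mathcal C_L\ne\emptyset$.) 3. There is an algorithm (a single program for a unit-cost random access machine whose only arithmetic operations are $\pm1$ and whose arrays are two-dimensional) that, given two connected graphs $G,G'$ on $\{0,\dots,n-1\}$, each with a vertex of even degree, by their adjacency matrices, and a list $L$ of $\ell\ge 0$ linear constraints by their coefficients, outputs an element of $\mathcal C_L$ if there is one and reports that there is none otherwise, in $O((n^2+\ell)n^2)$ steps, with an absolute implied constant. -/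

import Mathlib

/-! ## The two equations on quadruples of vertex sets -/

section Bouchet

variable {V : Type*}

/-- Equation (i), for sets of vertices `A B C D`, all cardinalities being taken mod 2. -/
def EquationI (G G' : SimpleGraph V) (A B C D : Set V) : Prop :=
  ∀ u v : V,
    Even ((B ∩ G.neighborSet u ∩ G'.neighborSet v).ncard
      + (A ∩ G.neighborSet u ∩ {v}).ncard
      + (D ∩ {u} ∩ G'.neighborSet v).ncard
      + (C ∩ {u} ∩ {v}).ncard)

/-- Equation (ii). -/
def EquationII (A B C D : Set V) : Prop :=
  symmDiff (A ∩ D) (B ∩ C) = Set.univ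

/-- A quadruple `(A, B, C, D)` of sets of vertices, encoded by the indicator vectors over `𝔽₂`
of its components, which are numbered `0, 1, 2, 3` in this order. -/
abbrev Quad (V : Type*) : Type _ := Fin 4 → V → ZMod 2

/-- The `s`-th set of vertices of a quadruple. -/
def Quad.set (x : Quad V) (s : Fin 4) : Set V := {v | x s v = 1}

/-- The quadruple satisfies (i). -/
def Quad.SatI (G G' : SimpleGraph V) (x : Quad V) : Prop :=
  EquationI G G' (x.set 0) (x.set 1) (x.set 2) (x.set 3)

/-- The quadruple satisfies (ii). -/
def Quad.SatII (x : Quad V) : Prop :=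
  EquationII (x.set 0) (x.set 1) (x.set 2) (x.set 3)

/-- The quadruple satisfies the linear constraint `∑ c s v * x s v = 0` with coefficients `c`. -/
def Quad.SatConstraint [Fintype V] (c x : Quad V) : Prop :=
  ∑ s, ∑ v, c s v * x s v = 0

theorem ncard_cast_eq_sum [Fintype V] (x : V → ZMod 2) (S : Set V) (p : V → ZMod 2)
    (hp : ∀ w, (w ∈ S → p w = 1) ∧ (w ∉ S → p w = 0)) :
    ((({w | x w = 1} ∩ S).ncard : ℕ) : ZMod 2) = ∑ w, x w * p w := by
  classical
  have h2 : ∀ a : ZMod 2, a = 0 ∨ a = 1 := by decide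
  rw [Set.ncard_eq_toFinset_card', Finset.card_eq_sum_ones, Nat.cast_sum]
  have hf : ({w | x w = 1} ∩ S).toFinset = Finset.univ.filter (fun w => x w = 1 ∧ w ∈ S) := by
    ext w; simp
  rw [hf, Finset.sum_filter]
  refine Finset.sum_congr rfl fun w _ => ?_
  by_cases hw : w ∈ S
  · rcases h2 (x w) with h | h <;> simp [h, hw, (hp w).1 hw]
  · simp [hw, (hp w).2 hw]

open scoped Classical in
/-- Equation (i) is linear over `𝔽₂`: it reads `Γ B Γ' + Γ A + D Γ' + C = 0`, entry by entry. -/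
theorem Quad.satI_iff [Fintype V] (G G' : SimpleGraph V) (x : Quad V) :
    x.SatI G G' ↔ ∀ u v : V,
      (∑ w, x 1 w * (if G.Adj u w ∧ G'.Adj v w then 1 else 0))
        + (∑ w, x 0 w * (if G.Adj u w ∧ w = v then 1 else 0))
        + (∑ w, x 3 w * (if w = u ∧ G'.Adj v w then 1 else 0))
        + (∑ w, x 2 w * (if w = u ∧ w = v then 1 else 0)) = 0 := by
  unfold Quad.SatI EquationI
  refine forall_congr' fun u => forall_congr' fun v => ?_
  simp only [Set.inter_assoc, Quad.set]
  rw [← ZMod.natCast_eq_zero_iff_even]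
  push_cast
  rw [ncard_cast_eq_sum (x 1) (G.neighborSet u ∩ G'.neighborSet v)
      (fun w => if G.Adj u w ∧ G'.Adj v w then 1 else 0) (by intro w; simp [imp_iff_not_or]; try tauto),
    ncard_cast_eq_sum (x 0) (G.neighborSet u ∩ {v})
      (fun w => if G.Adj u w ∧ w = v then 1 else 0) (by intro w; simp [imp_iff_not_or]; try tauto),
    ncard_cast_eq_sum (x 3) ({u} ∩ G'.neighborSet v)
      (fun w => if w = u ∧ G'.Adj v w then 1 else 0) (by intro w; simp [imp_iff_not_or]; try tauto),
    ncard_cast_eq_sum (x 2) ({u} ∩ {v})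
      (fun w => if w = u ∧ w = v then 1 else 0) (by intro w; simp [imp_iff_not_or]; try tauto)]

/-- The space `S_L` of the quadruples that satisfy (i) and all the constraints of `L`. -/
def solutionSpace [Fintype V] (G G' : SimpleGraph V) (L : Set (Quad V)) :
    Submodule (ZMod 2) (Quad V) where
  carrier := {x | x.SatI G G' ∧ ∀ c ∈ L, Quad.SatConstraint c x}
  zero_mem' := by
    classical
    refine ⟨(Quad.satI_iff G G' 0).2 fun u v => by simp, fun c _ => ?_⟩
    simp [Quad.SatConstraint]
  add_mem' := by
    classical
    rintro x y ⟨hx, hx'⟩ ⟨hy, hy'⟩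
    refine ⟨(Quad.satI_iff G G' _).2 fun u v => ?_, fun c hc => ?_⟩
    · have h1 := (Quad.satI_iff G G' x).1 hx u v
      have h2 := (Quad.satI_iff G G' y).1 hy u v
      simp only [Pi.add_apply, add_mul, Finset.sum_add_distrib]
      linear_combination h1 + h2
    · have h1 := hx' c hc
      have h2 := hy' c hc
      unfold Quad.SatConstraint at *
      simp only [Pi.add_apply, mul_add, Finset.sum_add_distrib]
      rw [h1, h2, add_zero]
  smul_mem' := by
    classical
    rintro a x ⟨hx, hx'⟩
    refine ⟨(Quad.satI_iff G G' _).2 fun u v => ?_, fun c hc => ?_⟩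
    · have h1 := (Quad.satI_iff G G' x).1 hx u v
      simp only [Pi.smul_apply, smul_eq_mul, mul_assoc, ← Finset.mul_sum]
      linear_combination a * h1
    · have h1 := hx' c hc
      unfold Quad.SatConstraint at *
      simp only [Pi.smul_apply, smul_eq_mul, mul_left_comm _ a, ← Finset.mul_sum]
      rw [h1, mul_zero]

open scoped Classical in
/-- The graph has a vertex of even degree. -/
def HasEvenDegreeVertex [Fintype V] (G : SimpleGraph V) : Prop :=
  ∃ v : V, Even (G.degree v)

/-- Local complementation `G ⋆ w`: the subgraph induced by the neighbourhood of `w` is replaced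
by its complement. -/
def localComplement (G : SimpleGraph V) (w : V) : SimpleGraph V where
  Adj u v := u ≠ v ∧ Xor (G.Adj u v) (G.Adj w u ∧ G.Adj w v)
  symm := ⟨by
    rintro u v ⟨hne, h⟩
    refine ⟨hne.symm, ?_⟩
    rwa [G.adj_comm v u, and_comm (a := G.Adj w v)]⟩
  loopless := ⟨fun _ h => h.1 rfl⟩

/-- `G' = G ⋆ a₁ ⋆ ⋯ ⋆ aₘ` for some sequence of (possibly repeating) vertices. -/
def LCEquivalent (G G' : SimpleGraph V) : Prop :=
  ∃ a : List V, G' = a.foldl localComplement G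

end Bouchet

/-! ## The machine model

A unit-cost random access machine, programmed in structured form. It has registers and
two-dimensional arrays, all holding natural numbers. A program is a fixed finite text, so it is the
same for all inputs. Every elementary instruction and every evaluation of a test costs one step. The
only arithmetic is `± 1`, so that after `T` steps no entry exceeds by more than `T` the largest
number in the input or in the program: a step never handles more than a logarithmic number
of bits. -/

namespace RAM

/-- The contents of the registers, and of the arrays: `mem a i j` is the entry `(i, j)` of the
array number `a`. -/
@[ext]
structure State where
  reg : ℕ → ℕ
  mem : ℕ → ℕ → ℕ → ℕ

/-- `reg x := k`. -/
def State.setReg (σ : State) (x k : ℕ) : State :=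
  { σ with reg := Function.update σ.reg x k }

/-- `mem a i j := k`. -/
def State.setMem (σ : State) (a i j k : ℕ) : State :=
  { σ with mem := fun a' i' j' => if a' = a ∧ i' = i ∧ j' = j then k else σ.mem a' i' j' }

/-- Comparisons between two registers. -/
inductive Test where
  | eq (x y : ℕ)
  | lt (x y : ℕ)

/-- The truth value of a comparison. -/
def Test.Holds (σ : State) : Test → Prop
  | .eq x y => σ.reg x = σ.reg y
  | .lt x y => σ.reg x < σ.reg y

/-- Elementary instructions; `x`, `y`, `i`, `j` are names of registers, `a` is the name of an array
and `k` is a numeral of the program text. -/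
inductive Instr where
  | const (x k : ℕ)
  | copy (x y : ℕ)
  | succ (x : ℕ)
  | pred (x : ℕ)
  | load (x a i j : ℕ)
  | store (a i j x : ℕ)

/-- The effect of an elementary instruction. -/
def Instr.apply (σ : State) : Instr → State
  | .const x k => σ.setReg x k
  | .copy x y => σ.setReg x (σ.reg y)
  | .succ x => σ.setReg x (σ.reg x + 1)
  | .pred x => σ.setReg x (σ.reg x - 1)
  | .load x a i j => σ.setReg x (σ.mem a (σ.reg i) (σ.reg j))
  | .store a i j x => σ.setMem a (σ.reg i) (σ.reg j) (σ.reg x)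

/-- Programs. -/
inductive Prog where
  | skip
  | instr (c : Instr)
  | seq (P Q : Prog)
  | ite (t : Test) (P Q : Prog)
  | while (t : Test) (P : Prog)

/-- `Runs P σ T τ`: the program `P`, started in the state `σ`, halts after exactly `T` steps in the
state `τ`. -/
inductive Runs : Prog → State → ℕ → State → Prop where
  | skip (σ : State) : Runs .skip σ 0 σ
  | instr (c : Instr) (σ : State) : Runs (.instr c) σ 1 (c.apply σ)
  | seq {P Q : Prog} {σ τ υ : State} {m n : ℕ} :
      Runs P σ m τ → Runs Q τ n υ → Runs (.seq P Q) σ (m + n) υ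
  | ite_true {t : Test} {P Q : Prog} {σ τ : State} {m : ℕ} :
      t.Holds σ → Runs P σ m τ → Runs (.ite t P Q) σ (m + 1) τ
  | ite_false {t : Test} {P Q : Prog} {σ τ : State} {m : ℕ} :
      ¬ t.Holds σ → Runs Q σ m τ → Runs (.ite t P Q) σ (m + 1) τ
  | while_true {t : Test} {P : Prog} {σ τ υ : State} {m n : ℕ} :
      t.Holds σ → Runs P σ m τ → Runs (.while t P) τ n υ →
        Runs (.while t P) σ (m + n + 1) υ
  | while_false {t : Test} {P : Prog} {σ : State} :
      ¬ t.Holds σ → Runs (.while t P) σ 1 σ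

end RAM

open scoped Classical in
/-- The adjacency matrix of a graph on `{0, …, n - 1}`, as the contents of an array
(zero outside the matrix). -/
noncomputable def adjArray {n : ℕ} (G : SimpleGraph (Fin n)) (i j : ℕ) : ℕ :=
  if ∃ u v : Fin n, (u : ℕ) = i ∧ (v : ℕ) = j ∧ G.Adj u v then 1 else 0

/-- The coefficients of the constraints on the `s`-th component, as the contents of an array:
one row for each constraint, one column for each vertex (zero outside). -/
def constraintArray {n l : ℕ} (L : Fin l → Quad (Fin n)) (s : Fin 4) (i j : ℕ) : ℕ :=
  if h : i < l ∧ j < n then (L ⟨i, h.1⟩ s ⟨j, h.2⟩).val else 0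

/-- The initial state: register `0` holds `n`, register `1` holds the number of constraints, the
arrays `0` and `1` hold the two adjacency matrices, and the arrays `2, 3, 4, 5` hold the coefficients
of the constraints on the four components. All the rest is zero. -/
noncomputable def inputState {n l : ℕ} (G G' : SimpleGraph (Fin n)) (L : Fin l → Quad (Fin n)) :
    RAM.State where
  reg x := match x with
    | 0 => n
    | 1 => l
    | _ => 0
  mem a := match a with
    | 0 => adjArray G
    | 1 => adjArray G'
    | 2 => constraintArray L 0
    | 3 => constraintArray L 1
    | 4 => constraintArray L 2
    | 5 => constraintArray L 3
    | _ => fun _ _ => 0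

/-- The final state announces that there is no solution: register `0` holds `0`. -/
def AnnouncesNone (τ : RAM.State) : Prop := τ.reg 0 = 0

/-- The final state announces the solution `x`: register `0` holds `1`, and row `s` of the array `6`
holds the indicator vector of the `s`-th component of `x`. -/
def AnnouncesSolution {n : ℕ} (τ : RAM.State) (x : Quad (Fin n)) : Prop :=
  τ.reg 0 = 1 ∧ ∀ (s : Fin 4) (v : Fin n), τ.mem 6 s v = (x s v).val

/-! ### Quadruples as fields of 2×2 matrices over `𝔽₂` -/

section QuadAlgebra

open Matrix

/-! Read a quadruple as a matrix `[[a, b], [c, d]]` at each vertex. With `Γ`, `Γ'` the adjacency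
matrices, (i) says that the block matrix `[[A, B], [C, D]]` with diagonal blocks maps `{(p, Γ'p)}`
into `{(q, Γq)}`, and (ii) says that all determinants `ad + bc` are 1. Hence solutions of (i)
compose (`Quad.SatI.comp`), and adjugates are solutions with the graphs exchanged (`Quad.SatI.adj`).

Dichotomy. The product of `x` with its adjugate is the diagonal field `det x`, and (i) for this
field from `G` to `G` says that `det x` agrees on adjacent vertices. So for connected `G` the
determinant is one quadratic form `q` on the solution space, and `C_L` is its level set `q = 1`. If
`q x = q y = 1` and the polar form is 1, then `x` times the adjugate of `y` has determinant and
trace 1 everywhere, hence both off-diagonal entries 1; a diagonal entry of (i) then reads `deg v + 1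
= 0`, impossible at a vertex of even degree. So vectors of norm one are pairwise orthogonal, and a
general fact on quadratic forms (`exists_affineSubspace_of_polar_eq_zero`) makes them an affine
subspace of codimension at most 2, or the empty set.

LC-equivalence. A local complementation at `a` is the solution `A = D = V`, `B = {a}`, `C = N(a)`,
so sequences of them give solutions by composition. Conversely, one or two local complementations
remove a vertex from `B`; once `B` is empty, (ii) gives `A = D = V` and (i) gives equality of the
graphs.

Algorithm. A family of `4n + 1` rows spanning the current space is cut down by one linear equation
after another: a row not orthogonal to the equation is added to every such row, itself included.
Each of the `n² + ℓ` equations costs `O(n²)`. A quadratic form that is nonzero on a span is nonzero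
at a generator or at a sum of two, so inspecting pairs of rows finds a solution of (ii) if there is
one (`exists_add_satII`), in cubic time. -/

theorem ZMod.eq_zero_or_eq_one_of_two (a : ZMod 2) : a = 0 ∨ a = 1 := by
  revert a; decide

/-- The composition law behind (i), in any ring of characteristic two. -/
theorem ring_compose {R : Type*} [Ring R] (h2 : ∀ x : R, x + x = 0)
    {g g' g'' a₁ b₁ c₁ d₁ a₂ b₂ c₂ d₂ : R}
    (h₁ : g * b₁ * g' + g * a₁ + d₁ * g' + c₁ = 0)
    (h₂ : g' * b₂ * g'' + g' * a₂ + d₂ * g'' + c₂ = 0) :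
    g * (b₁ * d₂ + a₁ * b₂) * g'' + g * (b₁ * c₂ + a₁ * a₂) + (c₁ * b₂ + d₁ * d₂) * g''
      + (c₁ * a₂ + d₁ * c₂) = 0 := by
  -- The first relation times `b₂ g'' + a₂` and `g b₁ + d₁` times the second share all terms
  -- containing `g'`. The doubled last term only corrects a sign.
  have key : g * (b₁ * d₂ + a₁ * b₂) * g'' + g * (b₁ * c₂ + a₁ * a₂)
      + (c₁ * b₂ + d₁ * d₂) * g'' + (c₁ * a₂ + d₁ * c₂)
      = (g * b₁ * g' + g * a₁ + d₁ * g' + c₁) * (b₂ * g'' + a₂)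
        - (g * b₁ + d₁) * (g' * b₂ * g'' + g' * a₂ + d₂ * g'' + c₂)
        + ((g * b₁ + d₁) * (d₂ * g'' + c₂) + (g * b₁ + d₁) * (d₂ * g'' + c₂)) := by
    noncomm_ring
  rw [key, h₁, h₂, h2]
  simp

variable {V : Type*}

open scoped Classical in
/-- Equation (i) as an identity between matrices. -/
theorem Quad.satI_iff_matrix [Fintype V] (G G' : SimpleGraph V) (x : Quad V) :
    x.SatI G G' ↔
      G.adjMatrix (ZMod 2) * diagonal (x 1) * G'.adjMatrix (ZMod 2)
        + G.adjMatrix (ZMod 2) * diagonal (x 0) + diagonal (x 3) * G'.adjMatrix (ZMod 2)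
        + diagonal (x 2) = 0 := by
  rw [Quad.satI_iff, ← Matrix.ext_iff]
  refine forall_congr' fun u => forall_congr' fun v => ?_
  have e1 : (G.adjMatrix (ZMod 2) * diagonal (x 1) * G'.adjMatrix (ZMod 2)) u v
      = ∑ w, x 1 w * (if G.Adj u w ∧ G'.Adj v w then 1 else 0) := by
    rw [Matrix.mul_apply]
    refine Finset.sum_congr rfl fun w _ => ?_
    rw [Matrix.mul_diagonal, SimpleGraph.adjMatrix_apply, SimpleGraph.adjMatrix_apply,
      G'.adj_comm w v]
    by_cases h : G.Adj u w <;> by_cases h' : G'.Adj v w <;> simp [h, h']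
  have e2 : (G.adjMatrix (ZMod 2) * diagonal (x 0)) u v
      = ∑ w, x 0 w * (if G.Adj u w ∧ w = v then 1 else 0) := by
    rw [Matrix.mul_diagonal, Finset.sum_eq_single v]
    · simp [SimpleGraph.adjMatrix_apply]
    · intro w _ hw; simp [hw]
    · simp
  have e3 : (diagonal (x 3) * G'.adjMatrix (ZMod 2)) u v
      = ∑ w, x 3 w * (if w = u ∧ G'.Adj v w then 1 else 0) := by
    rw [Matrix.diagonal_mul, Finset.sum_eq_single u]
    · simp [SimpleGraph.adjMatrix_apply, G'.adj_comm u v]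
    · intro w _ hw; simp [hw]
    · simp
  have e4 : diagonal (x 2) u v = ∑ w, x 2 w * (if w = u ∧ w = v then 1 else 0) := by
    rw [Finset.sum_eq_single u]
    · by_cases h : u = v <;> simp [h]
    · intro w _ hw; simp [hw]
    · simp
  simp only [Matrix.add_apply, Matrix.zero_apply, e1, e2, e3, e4]

/-- The determinant at the vertex `v` of the 2×2 matrices that make up a quadruple. -/
def Quad.det (x : Quad V) (v : V) : ZMod 2 := x 0 v * x 3 v + x 1 v * x 2 v

/-- The polar form of `Quad.det`. -/
def Quad.polar (x y : Quad V) (v : V) : ZMod 2 :=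
  x 0 v * y 3 v + x 3 v * y 0 v + (x 1 v * y 2 v + x 2 v * y 1 v)

theorem Quad.det_add (x y : Quad V) (v : V) :
    (x + y).det v = x.det v + y.det v + x.polar y v := by
  simp only [Quad.det, Quad.polar, Pi.add_apply]; ring

theorem Quad.polar_add_right (x y z : Quad V) (v : V) :
    x.polar (y + z) v = x.polar y v + x.polar z v := by
  simp only [Quad.polar, Pi.add_apply]; ring

theorem Quad.polar_add_left (x y z : Quad V) (v : V) :
    (x + y).polar z v = x.polar z v + y.polar z v := by
  simp only [Quad.polar, Pi.add_apply]; ring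

theorem Quad.polar_comm (x y : Quad V) (v : V) : x.polar y v = y.polar x v := by
  simp only [Quad.polar]; ring

/-- Symmetric difference is addition of indicators, so (ii) asks for an invertible matrix at every
vertex. -/
theorem Quad.satII_iff (x : Quad V) : x.SatII ↔ ∀ v, x.det v = 1 := by
  unfold Quad.SatII EquationII
  rw [Set.eq_univ_iff_forall]
  refine forall_congr' fun v => ?_
  simp only [Set.mem_symmDiff, Set.mem_inter_iff, Quad.set, Set.mem_ofPred_eq, Quad.det]
  generalize x 0 v = a; generalize x 1 v = b; generalize x 2 v = c; generalize x 3 v = d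
  revert a b c d; decide

/-- The quadruple of componentwise products of 2×2 matrices. -/
def Quad.comp (x y : Quad V) : Quad V :=
  ![fun v => x 1 v * y 2 v + x 0 v * y 0 v, fun v => x 1 v * y 3 v + x 0 v * y 1 v,
    fun v => x 2 v * y 0 v + x 3 v * y 2 v, fun v => x 2 v * y 1 v + x 3 v * y 3 v]

theorem Quad.det_comp (x y : Quad V) (v : V) : (x.comp y).det v = x.det v * y.det v := by
  simp only [Quad.det, Quad.comp, Matrix.cons_val]
  generalize x 0 v = a; generalize x 1 v = b; generalize x 2 v = c; generalize x 3 v = d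
  generalize y 0 v = a'; generalize y 1 v = b'; generalize y 2 v = c'; generalize y 3 v = d'
  revert a b c d a' b' c' d'; decide

/-- The quadruple of the adjugate matrices. -/
def Quad.adj (x : Quad V) : Quad V := ![x 3, x 1, x 2, x 0]

theorem Quad.det_adj (x : Quad V) (v : V) : x.adj.det v = x.det v := by
  simp [Quad.det, Quad.adj, mul_comm]

variable [Fintype V] {G G' G'' : SimpleGraph V}

/-- Linear maps carrying `{(p, Γ''p)}` into `{(p, Γ'p)}` and the latter into `{(p, Γp)}` compose;
the product is taken vertex by vertex because the blocks are diagonal. -/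
theorem Quad.SatI.comp {x y : Quad V} (hx : x.SatI G G') (hy : y.SatI G' G'') :
    (x.comp y).SatI G G'' := by
  classical
  rw [Quad.satI_iff_matrix] at *
  have h2 : ∀ M : Matrix V V (ZMod 2), M + M = 0 := fun M => by
    ext i j; exact CharTwo.add_self_eq_zero _
  have h := ring_compose h2 hx hy
  simp only [diagonal_mul_diagonal, diagonal_add] at h
  exact h

/-- Adjacency matrices are symmetric, so transposing (i) exchanges the two graphs and swaps `A` with
`D`. -/
theorem Quad.SatI.adj {x : Quad V} (hx : x.SatI G G') : x.adj.SatI G' G := by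
  classical
  rw [Quad.satI_iff_matrix] at *
  have h := congrArg Matrix.transpose hx
  simp only [transpose_add, transpose_mul, diagonal_transpose, SimpleGraph.transpose_adjMatrix,
    transpose_zero, ← Matrix.mul_assoc] at h
  rw [← h]
  simp only [Quad.adj, Matrix.cons_val]
  abel

open scoped Classical in
theorem Quad.SatI.entry {x : Quad V} (hx : x.SatI G G') (u v : V) :
    (∑ w, G.adjMatrix (ZMod 2) u w * x 1 w * G'.adjMatrix (ZMod 2) w v)
      + G.adjMatrix (ZMod 2) u v * x 0 v + x 3 u * G'.adjMatrix (ZMod 2) u v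
      + (if u = v then x 2 u else 0) = 0 := by
  have h := congrFun (congrFun ((Quad.satI_iff_matrix G G' x).1 hx) u) v
  simpa only [Matrix.add_apply, Matrix.mul_apply (M := G.adjMatrix (ZMod 2) * _),
    Matrix.mul_diagonal, Matrix.diagonal_mul, Matrix.zero_apply, Matrix.diagonal_apply] using h

/-- If `G` is connected, the determinants of a solution of (i) are the same at all vertices. -/
theorem Quad.SatI.det_eq {x : Quad V} (hG : G.Connected) (hx : x.SatI G G') (u v : V) :
    x.det u = x.det v := by
  classical
  -- This product has `B = C = 0` and `A = D = det x`, so at an edge `uv` its equation (i) is `det v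
  -- + det u = 0`.
  have hs := hx.comp hx.adj
  have hadj : ∀ u v, G.Adj u v → x.det u = x.det v := by
    intro u v huv
    have h := hs.entry u v
    have h0 : (x.comp x.adj) 0 = x.det := by
      funext w; simp [Quad.comp, Quad.adj, Quad.det]; ring
    have h3 : (x.comp x.adj) 3 = x.det := by
      funext w; simp [Quad.comp, Quad.adj, Quad.det]; ring
    have h1 : (x.comp x.adj) 1 = 0 := by
      funext w; simp [Quad.comp, Quad.adj, mul_comm (x 0 w), CharTwo.add_self_eq_zero]
    rw [h0, h3, h1] at h
    simp [SimpleGraph.adjMatrix_apply, huv, huv.ne] at h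
    exact (CharTwo.add_eq_zero.1 h).symm
  obtain ⟨p⟩ := hG.preconnected u v
  induction p with
  | nil => rfl
  | cons h _ ih => exact (hadj _ _ h).trans ih

/-- If `G` has a vertex of even degree, two solutions of (i) and (ii) cannot be polar to each other
everywhere. -/
theorem Quad.SatI.exists_polar_eq_zero {x y : Quad V} (hG : HasEvenDegreeVertex G)
    (hx : x.SatI G G') (hy : y.SatI G G') (hx' : x.SatII) (hy' : y.SatII) :
    ∃ v, x.polar y v = 0 := by
  classical
  by_contra! hne
  have hs := hx.comp hy.adj
  set z := x.comp y.adj with hz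
  -- `z` has determinant 1 and its trace is the polar form, here 1. Trace 1 forces `ad = 0`, hence
  -- `bc = 1`.
  have hpt : ∀ v, z 1 v = 1 ∧ z 2 v = 1 := by
    intro v
    have hd : z.det v = 1 := by
      rw [hz, Quad.det_comp, Quad.det_adj, (Quad.satII_iff x).1 hx', (Quad.satII_iff y).1 hy',
        mul_one]
    have ht : z 0 v + z 3 v = 1 := by
      rw [← (ZMod.eq_zero_or_eq_one_of_two (x.polar y v)).resolve_left (hne v)]
      simp [hz, Quad.comp, Quad.adj, Quad.polar]; ring
    revert hd ht
    unfold Quad.det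
    generalize z 0 v = a; generalize z 1 v = b; generalize z 2 v = c; generalize z 3 v = d
    revert a b c d; decide
  obtain ⟨v, hv⟩ := hG
  -- With `B = C = V` the diagonal entry is `deg v + 1`.
  have h := hs.entry v v
  have hsum : ∑ w, G.adjMatrix (ZMod 2) v w * z 1 w * G.adjMatrix (ZMod 2) w v
      = (G.degree v : ZMod 2) := by
    rw [← SimpleGraph.card_neighborFinset_eq_degree, Finset.card_eq_sum_ones, Nat.cast_sum,
      SimpleGraph.neighborFinset_eq_filter, Finset.sum_filter]
    refine Finset.sum_congr rfl fun w _ => ?_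
    by_cases hw : G.Adj v w <;> simp [SimpleGraph.adjMatrix_apply, hw, G.adj_comm w v, (hpt w).1]
  have hv0 : ((G.degree v : ℕ) : ZMod 2) = 0 := by
    rw [ZMod.natCast_eq_zero_iff_even]
    convert hv
  rw [hsum, hv0] at h
  simp [SimpleGraph.adjMatrix_apply, (hpt v).2] at h

end QuadAlgebra

/-! ### Level sets of quadratic forms, and the dichotomy -/

section Dichotomy

/-- In a quadratic space over `𝔽₂` where any two vectors of norm one are orthogonal, the vectors of
norm one form an affine subspace of codimension at most two, unless there are none. -/
theorem exists_affineSubspace_of_polar_eq_zero {E : Type*} [AddCommGroup E] [Module (ZMod 2) E]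
    [FiniteDimensional (ZMod 2) E] (q : E → ZMod 2) (b : E → E → ZMod 2)
    (hq : ∀ x y, q (x + y) = q x + q y + b x y)
    (hb : ∀ x y z, b x (y + z) = b x y + b x z) (hb' : ∀ x y z, b (x + y) z = b x z + b y z)
    (h : ∀ x y, q x = 1 → q y = 1 → b x y = 0) (x₀ : E) (hx₀ : q x₀ = 1) :
    ∃ A : AffineSubspace (ZMod 2) E, (A : Set E) = {x | q x = 1} ∧
      Module.finrank (ZMod 2) (E ⧸ A.direction) ≤ 2 := by
  have hadd : ∀ x : E, x + x = 0 := fun x => by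
    rw [← two_smul (ZMod 2) x, show (2 : ZMod 2) = 0 from rfl, zero_smul]
  have hsub : ∀ x y : E, x - y = x + y := fun x y => by
    rw [sub_eq_iff_eq_add, add_assoc, hadd, add_zero]
  have hz : ∀ a : ZMod 2, a + a = 0 := CharTwo.add_self_eq_zero
  -- Over `𝔽₂`, being affine means closure under `x + y + z`; for pairwise orthogonal vectors of
  -- norm one, `q` is additive on this sum.
  let A : AffineSubspace (ZMod 2) E :=
    { carrier := {x | q x = 1}
      smul_vsub_vadd_mem' := by
        intro c x y z hx hy hz
        have hx : q x = 1 := hx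
        have hy : q y = 1 := hy
        have hz : q z = 1 := hz
        change q (c • (x - y) + z) = 1
        rcases ZMod.eq_zero_or_eq_one_of_two c with rfl | rfl
        · simpa using hz
        · rw [one_smul, hsub, hq, hq, hb', h x y hx hy, h x z hx hz, h y z hy hz, hx, hy, hz]
          decide }
  have hA : ∀ x, x ∈ A ↔ q x = 1 := fun x => Iff.rfl
  refine ⟨A, rfl, ?_⟩
  have hsmul : ∀ (c : ZMod 2) (x : E), b x₀ (c • x) = c * b x₀ x := by
    intro c x
    rcases ZMod.eq_zero_or_eq_one_of_two c with rfl | rfl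
    · have := hb x₀ 0 0
      simp only [add_zero, hz] at this
      simpa using this
    · simp
  let f : E →ₗ[ZMod 2] ZMod 2 := { toFun := b x₀, map_add' := hb x₀, map_smul' := hsmul }
  have hq0 : q 0 = 0 := by
    have h1 := hq 0 0
    have h2 := hb 0 0 0
    simp only [add_zero, hz] at h1 h2
    rw [h1, h2, add_zero]
  have hfq : ∀ x, b x₀ x = 0 → q x = 0 → q (x₀ + x) = 1 := fun x h1 h2 => by
    rw [hq, hx₀, h1, h2]; rfl
  have hcomm : ∀ x y, b x y = b y x := fun x y => by
    have h1 := hq x y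
    rw [add_comm x y, hq y x] at h1
    linear_combination -h1
  -- Inside the orthogonal complement of `x₀`, adding `x₀` turns norm zero into norm one and leaves
  -- `b` unchanged, so the orthogonality of norm-one vectors extends to all pairs there. Thus `q` is
  -- linear on `ker f`.
  have hker : ∀ x y, b x₀ x = 0 → b x₀ y = 0 → b x y = 0 := by
    have aux : ∀ x y, q x = 0 → b x₀ x = 0 → b x₀ y = 0 → q y = 1 → b x y = 0 := by
      intro x y hx h1 h2 hy
      have := h _ _ (hfq x h1 hx) hy
      rwa [hb', h2, zero_add] at this
    intro x y h1 h2
    rcases ZMod.eq_zero_or_eq_one_of_two (q x) with hx | hx <;>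
      rcases ZMod.eq_zero_or_eq_one_of_two (q y) with hy | hy
    · have := h _ _ (hfq x h1 hx) (hfq y h2 hy)
      have h3 : b x₀ x₀ = 0 := h _ _ hx₀ hx₀
      rwa [hb', hb, hb, h2, h3, hcomm x x₀, h1, zero_add, zero_add, zero_add] at this
    · exact aux x y hx h1 h2 hy
    · rw [hcomm]; exact aux y x hy h2 h1 hx
    · exact h x y hx hy
  let g : LinearMap.ker f →ₗ[ZMod 2] ZMod 2 :=
    { toFun := fun x => q x
      map_add' := fun x y => by
        have := hker x y x.2 y.2
        simp only [Submodule.coe_add, hq, this, add_zero]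
      map_smul' := fun c x => by
        rcases ZMod.eq_zero_or_eq_one_of_two c with rfl | rfl <;> simp [hq0] }
  -- Extending `q` from `ker f` to a linear form on `E` presents the directions as containing the
  -- kernel of a map to `𝔽₂²`, which bounds the codimension by 2.
  obtain ⟨g', hg'⟩ := LinearMap.exists_extend g
  have hle : LinearMap.ker (f.prod g') ≤ A.direction := by
    intro x hx
    rw [LinearMap.ker_prod, Submodule.mem_inf] at hx
    have h1 : b x₀ x = 0 := hx.1
    have h2 : q x = 0 := by
      have h3 : g' x = g ⟨x, hx.1⟩ := by rw [← hg']; rfl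
      rw [← show g ⟨x, hx.1⟩ = q x from rfl, ← h3]
      exact hx.2
    have := AffineSubspace.vsub_mem_direction ((hA _).2 (hfq x h1 h2)) ((hA _).2 hx₀)
    simpa using this
  have h1 := Submodule.finrank_mono hle
  have h2 := (f.prod g').finrank_range_add_finrank_ker
  have h3 := A.direction.finrank_quotient_add_finrank
  have h4 := (LinearMap.range (f.prod g')).finrank_le
  rw [Module.finrank_prod, Module.finrank_self] at h4
  omega

/-- The determinant at any fixed vertex `v` serves as the quadratic form, since it has the same
value at all vertices. -/
theorem solutionSpace_dichotomy {V : Type*} [Fintype V] (G G' : SimpleGraph V)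
    (hG : G.Connected) (he : HasEvenDegreeVertex G) (L : Set (Quad V)) :
    {x : solutionSpace G G' L | (x : Quad V).SatII} = ∅ ∨
      ∃ E : AffineSubspace (ZMod 2) (solutionSpace G G' L),
        (E : Set (solutionSpace G G' L)) = {x : solutionSpace G G' L | (x : Quad V).SatII} ∧
        Module.finrank (ZMod 2) (solutionSpace G G' L ⧸ E.direction) ≤ 2 := by
  obtain ⟨v⟩ := hG.nonempty
  have hdet : ∀ (x : solutionSpace G G' L) w, (x : Quad V).det w = (x : Quad V).det v :=
    fun x w => x.2.1.det_eq hG w v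
  have hII : ∀ x : solutionSpace G G' L, (x : Quad V).SatII ↔ (x : Quad V).det v = 1 := by
    intro x
    rw [Quad.satII_iff]
    exact ⟨fun h => h v, fun h w => (hdet x w).trans h⟩
  simp only [hII]
  rcases Set.eq_empty_or_nonempty {x : solutionSpace G G' L | (x : Quad V).det v = 1} with h | h
  · exact Or.inl h
  · obtain ⟨x₀, hx₀⟩ := h
    refine Or.inr (exists_affineSubspace_of_polar_eq_zero (fun x : solutionSpace G G' L => (x : Quad V).det v)
      (fun x y => (x : Quad V).polar y v) (fun x y => Quad.det_add _ _ _)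
      (fun x y z => Quad.polar_add_right _ _ _ _) (fun x y z => Quad.polar_add_left _ _ _ _)
      (fun x y hx hy => ?_) x₀ hx₀)
    obtain ⟨w, hw⟩ := Quad.SatI.exists_polar_eq_zero he x.2.1 y.2.1 ((hII x).2 hx) ((hII y).2 hy)
    have h1 := Quad.det_add (x : Quad V) y w
    -- The polar form vanishes at `w`; as the determinants of `x`, `y` and `x + y` do not depend on
    -- the vertex, it vanishes at `v` as well.
    have h2 := Quad.det_add (x : Quad V) y v
    rw [← Submodule.coe_add, hdet (x + y), hdet x, hdet y, hw] at h1
    rw [← Submodule.coe_add, h1] at h2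
    simpa using h2

end Dichotomy

/-! ### LC-equivalence and solutions of (i), (ii) -/

section LocalComplementation

variable {V : Type*}

/-- The quadruple of a local complementation. -/
noncomputable def localQuad (G : SimpleGraph V) (a : V) : Quad V :=
  open scoped Classical in
  ![1, Pi.single a 1, fun v => if G.Adj a v then 1 else 0, 1]

theorem localQuad_satII (G : SimpleGraph V) (a : V) : (localQuad G a).SatII := by
  classical
  rw [Quad.satII_iff]
  intro v
  by_cases h : v = a
  · subst h; simp [Quad.det, localQuad]
  · simp [Quad.det, localQuad, h]

/-- The quadruple obtained from `x` by a local complementation at `a` of the first graph. -/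
noncomputable def Quad.step (G : SimpleGraph V) (a : V) (x : Quad V) : Quad V :=
  (localQuad G a).adj.comp x

/-- Only `B` and `D` matter for the descent on the size of `B`: `B` changes at `a` alone, by `D`,
and `D` changes at the neighbours of `a`, by `B`. -/
theorem Quad.step_one (G : SimpleGraph V) (a : V) (x : Quad V) (v : V) :
    (x.step G a) 1 v = x 1 v + (open scoped Classical in if v = a then x 3 v else 0) := by
  classical
  by_cases h : v = a
  · subst h; simp [Quad.step, Quad.comp, Quad.adj, localQuad, add_comm]
  · simp [Quad.step, Quad.comp, Quad.adj, localQuad, h]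

theorem Quad.step_three (G : SimpleGraph V) (a : V) (x : Quad V) (v : V) :
    (x.step G a) 3 v = x 3 v + (open scoped Classical in if G.Adj a v then x 1 v else 0) := by
  classical
  by_cases h : G.Adj a v <;> simp [Quad.step, Quad.comp, Quad.adj, localQuad, h, add_comm]

theorem Quad.step_satII (G : SimpleGraph V) (a : V) {x : Quad V} (hx : x.SatII) :
    (x.step G a).SatII := by
  rw [Quad.satII_iff] at *
  intro v
  rw [Quad.step, Quad.det_comp, Quad.det_adj, (Quad.satII_iff _).1 (localQuad_satII G a), hx,
    one_mul]

theorem LCEquivalent.of_localComplement {G G' : SimpleGraph V} (a : V)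
    (h : LCEquivalent (localComplement G a) G') : LCEquivalent G G' := by
  obtain ⟨l, hl⟩ := h
  exact ⟨a :: l, hl⟩

variable [Fintype V]

/-- Complementation at `a` preserves the neighbours of `a`, so off the diagonal (i) reads `Γ_ua Γ_av
+ Γ_uv + Γ'_uv = 0`, which defines the new graph; on the diagonal `C = N(a)` cancels `Γ_ua Γ_au`. -/
theorem localQuad_satI (G : SimpleGraph V) (a : V) :
    (localQuad G a).SatI G (localComplement G a) := by
  classical
  rw [Quad.satI_iff]
  intro u v
  rw [Finset.sum_eq_single a (by intro w _ hw; simp [localQuad, hw]) (by simp),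
    Finset.sum_eq_single v (by intro w _ hw; simp [hw]) (by simp),
    Finset.sum_eq_single u (by intro w _ hw; simp [hw]) (by simp),
    Finset.sum_eq_single u (by intro w _ hw; simp [hw]) (by simp)]
  simp only [localQuad, localComplement, Matrix.cons_val, Pi.single_eq_same, Pi.one_apply, one_mul,
    and_true, true_and, G.adj_comm u a, G.adj_comm v a, G.adj_comm v u]
  have hl : ¬ G.Adj a a := G.irrefl
  by_cases huv : u = v
  · subst huv
    have : ¬ G.Adj u u := G.irrefl
    by_cases h1 : G.Adj a u
    · have := h1.ne'
      simp [*, Xor]; try decide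
    · simp [*, Xor]
  · have hva : G.Adj a v → v ≠ a := fun h => h.ne'
    by_cases h1 : G.Adj a u <;> by_cases h2 : G.Adj a v <;> by_cases h3 : G.Adj u v <;>
      simp [h1, h2, h3, huv, Ne.symm huv, Xor, hva] <;> decide

theorem exists_quad_of_lcEquivalent {G G' : SimpleGraph V} (h : LCEquivalent G G') :
    ∃ x : Quad V, x.SatI G G' ∧ x.SatII := by
  classical
  obtain ⟨a, rfl⟩ := h
  induction a generalizing G with
  | nil =>
    refine ⟨![1, 0, 0, 1], ?_, (Quad.satII_iff _).2 fun v => by simp [Quad.det]⟩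
    change Quad.SatI G G _
    rw [Quad.satI_iff_matrix]
    ext i j
    simp [CharTwo.add_self_eq_zero]
  | cons w a ih =>
    obtain ⟨y, hy, hy'⟩ := ih (G := localComplement G w)
    refine ⟨(localQuad G w).comp y, (localQuad_satI G w).comp hy, (Quad.satII_iff _).2 fun v => ?_⟩
    rw [Quad.det_comp, (Quad.satII_iff _).1 (localQuad_satII G w), (Quad.satII_iff _).1 hy', one_mul]

theorem Quad.step_satI {G G' : SimpleGraph V} (a : V) {x : Quad V} (hx : x.SatI G G') :
    (x.step G a).SatI (localComplement G a) G' :=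
  (localQuad_satI G a).adj.comp hx

/-- Strong induction on `|B|`: local complementations of the first graph change the quadruple by
composition and can always be chosen to shrink `B`. -/
theorem lcEquivalent_of_quad {G G' : SimpleGraph V} {x : Quad V} (hI : x.SatI G G')
    (hII : x.SatII) : LCEquivalent G G' := by
  classical
  induction hm : (Finset.univ.filter fun v => x 1 v = 1).card using Nat.strong_induction_on
    generalizing G x with
  | _ m ih =>
  have ih' : ∀ (H : SimpleGraph V) (y : Quad V) (a : V), y.SatI H G' → y.SatII → x 1 a = 1 →
      y 1 a = 0 → (∀ v, v ≠ a → y 1 v = x 1 v) → LCEquivalent H G' := by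
    intro H y a h1 h2 hxa hya hyx
    refine ih _ ?_ h1 h2 rfl
    rw [← hm]
    refine Finset.card_lt_card (Finset.ssubset_iff_of_subset ?_ |>.2 ⟨a, by simp [hxa], by simp [hya]⟩)
    intro v hv
    simp only [Finset.mem_filter, Finset.mem_univ, true_and] at hv ⊢
    rw [← hyx v]
    · exact hv
    · rintro rfl; simp [hya] at hv
  have hdet := (Quad.satII_iff x).1 hII
  by_cases hB : ∀ v, x 1 v = 0
  · have h03 : ∀ v, x 0 v = 1 ∧ x 3 v = 1 := by
      intro v
      have := hdet v
      rw [Quad.det, hB v] at this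
      revert this
      generalize x 0 v = a; generalize x 2 v = c; generalize x 3 v = d
      revert a c d; decide
    refine ⟨[], ?_⟩
    ext u v
    by_cases huv : u = v
    · subst huv; simp
    · have h := hI.entry u v
      simp only [hB, mul_zero, zero_mul, Finset.sum_const_zero, zero_add, (h03 _).1, (h03 _).2,
        mul_one, one_mul, if_neg huv, add_zero, SimpleGraph.adjMatrix_apply] at h
      by_cases h1 : G.Adj u v <;> by_cases h2 : G'.Adj u v <;> simp_all
  · push Not at hB
    by_cases hd : ∃ a, x 1 a = 1 ∧ x 3 a = 1
    · obtain ⟨a, h1, h3⟩ := hd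
      refine .of_localComplement a (ih' _ _ a (Quad.step_satI a hI) (Quad.step_satII G a hII) h1 ?_ ?_)
      · rw [Quad.step_one, if_pos rfl, h1, h3]; rfl
      · intro v hv
        rw [Quad.step_one, if_neg hv, add_zero]
    · push Not at hd
      have hd' : ∀ v, x 1 v = 1 → x 3 v = 0 := fun v hv =>
        (ZMod.eq_zero_or_eq_one_of_two _).resolve_right (hd v hv)
      obtain ⟨v, hv⟩ := hB
      have hv1 : x 1 v = 1 := (ZMod.eq_zero_or_eq_one_of_two _).resolve_left hv
      -- Here `d v = 0`, so determinant 1 forces `c v = 1`. The `(v, v)` entry of (i) then makes the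
      -- sum over the common neighbours of `v` in `B` nonzero.
      have hex : ∃ u, G.Adj u v ∧ x 1 u = 1 := by
        by_contra! hno
        have hdv := hdet v
        rw [Quad.det, hv1, hd' v hv1] at hdv
        have h := hI.entry v v
        rw [Finset.sum_eq_zero] at h
        · simp [SimpleGraph.adjMatrix_apply] at h
          simp [h] at hdv
        · intro w _
          by_cases hw : G.Adj v w
          · simp [(ZMod.eq_zero_or_eq_one_of_two _).resolve_right (hno w hw.symm)]
          · simp [SimpleGraph.adjMatrix_apply, hw]
      obtain ⟨u, huv, hu⟩ := hex
      -- Complementing at `u` leaves `B` alone because `d u = 0`, and turns `d v` into 1;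
      -- complementing at `v` then removes `v` from `B`.
      refine .of_localComplement u (.of_localComplement v (ih' _ _ v
        (Quad.step_satI v (Quad.step_satI u hI))
        (Quad.step_satII _ v (Quad.step_satII _ u hII)) hv1 ?_ ?_))
      · rw [Quad.step_one, if_pos rfl, Quad.step_one, if_neg huv.ne', Quad.step_three, if_pos huv,
          hv1, hd' v hv1]
        rfl
      · intro w hw
        rw [Quad.step_one, if_neg hw, Quad.step_one]
        by_cases hwu : w = u
        · subst hwu; simp [hd' w hu]
        · simp [hwu]

theorem lcEquivalent_iff (G G' : SimpleGraph V) :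
    LCEquivalent G G' ↔ ∃ A B C D : Set V, EquationI G G' A B C D ∧ EquationII A B C D := by
  classical
  constructor
  · intro h
    obtain ⟨x, h1, h2⟩ := exists_quad_of_lcEquivalent h
    exact ⟨_, _, _, _, h1, h2⟩
  · rintro ⟨A, B, C, D, h1, h2⟩
    let x : Quad V := fun s v => if v ∈ (![A, B, C, D] : Fin 4 → Set V) s then 1 else 0
    have hx : ∀ s, x.set s = (![A, B, C, D] : Fin 4 → Set V) s := by
      intro s; ext v; simp [x, Quad.set]
    refine lcEquivalent_of_quad (x := x) ?_ ?_
    · unfold Quad.SatI; simpa only [hx, Matrix.cons_val] using h1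
    · unfold Quad.SatII; simpa only [hx, Matrix.cons_val] using h2

end LocalComplementation

/-! ### A program logic with time bounds -/

namespace RAM

@[simp] theorem State.setReg_reg (σ : State) (x k y : ℕ) :
    (σ.setReg x k).reg y = if y = x then k else σ.reg y := by
  simp [State.setReg, Function.update_apply]

@[simp] theorem State.setReg_mem (σ : State) (x k : ℕ) : (σ.setReg x k).mem = σ.mem := rfl

@[simp] theorem State.setMem_reg (σ : State) (a i j k : ℕ) : (σ.setMem a i j k).reg = σ.reg := rfl

@[simp] theorem State.setMem_mem (σ : State) (a i j k a' i' j' : ℕ) :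
    (σ.setMem a i j k).mem a' i' j' = if a' = a ∧ i' = i ∧ j' = j then k else σ.mem a' i' j' := rfl

/-- The registers a program may write to. -/
def Prog.regs : Prog → List ℕ
  | .skip => []
  | .instr (.const x _) => [x]
  | .instr (.copy x _) => [x]
  | .instr (.succ x) => [x]
  | .instr (.pred x) => [x]
  | .instr (.load x _ _ _) => [x]
  | .instr (.store _ _ _ _) => []
  | .seq P Q => P.regs ++ Q.regs
  | .ite _ P Q => P.regs ++ Q.regs
  | .while _ P => P.regs

/-- The arrays a program may write to. -/
def Prog.arrays : Prog → List ℕ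
  | .instr (.store a _ _ _) => [a]
  | .seq P Q => P.arrays ++ Q.arrays
  | .ite _ P Q => P.arrays ++ Q.arrays
  | .while _ P => P.arrays
  | _ => []

/-- The two states differ at most in the registers `R` and the arrays `A`. -/
def Agree (R A : List ℕ) (σ τ : State) : Prop :=
  (∀ x, x ∉ R → τ.reg x = σ.reg x) ∧ ∀ a, a ∉ A → τ.mem a = σ.mem a

theorem Agree.refl (R A : List ℕ) (σ : State) : Agree R A σ σ :=
  ⟨fun _ _ => rfl, fun _ _ => rfl⟩

theorem Agree.trans {R A : List ℕ} {σ τ υ : State} (h : Agree R A σ τ) (h' : Agree R A τ υ) :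
    Agree R A σ υ :=
  ⟨fun x hx => (h'.1 x hx).trans (h.1 x hx), fun a ha => (h'.2 a ha).trans (h.2 a ha)⟩

theorem Agree.mono {R A R' A' : List ℕ} {σ τ : State} (h : Agree R A σ τ) (hR : R ⊆ R')
    (hA : A ⊆ A') : Agree R' A' σ τ :=
  ⟨fun x hx => h.1 x fun h' => hx (hR h'), fun a ha => h.2 a fun h' => ha (hA h')⟩

/-- This is the frame rule: preservation of a register or array across a program reduces to a
decidable check on the program text. -/
theorem Runs.agree {P : Prog} {σ τ : State} {m : ℕ} (h : Runs P σ m τ) :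
    Agree P.regs P.arrays σ τ := by
  induction h with
  | skip σ => exact .refl _ _ _
  | instr c σ =>
    constructor
    · intro x hx
      cases c <;> simp_all [Prog.regs, Instr.apply]
    · intro a ha
      cases c <;> simp_all [Prog.arrays, Instr.apply]
      funext i j
      simp [ha]
  | seq _ _ h1 h2 =>
    exact (h1.mono (by simp [Prog.regs]) (by simp [Prog.arrays])).trans
      (h2.mono (by simp [Prog.regs]) (by simp [Prog.arrays]))
  | ite_true _ _ h => exact h.mono (by simp [Prog.regs]) (by simp [Prog.arrays])
  | ite_false _ _ h => exact h.mono (by simp [Prog.regs]) (by simp [Prog.arrays])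
  | while_true _ _ _ h1 h2 => exact h1.trans h2
  | while_false _ => exact .refl _ _ _

/-- Started in the state `σ`, the program `P` halts after at most `T` steps, in a state that
satisfies `Q`. -/
def Meets (P : Prog) (σ : State) (T : ℕ) (Q : State → Prop) : Prop :=
  ∃ m τ, Runs P σ m τ ∧ m ≤ T ∧ Q τ

variable {P P' : Prog} {σ : State} {T T' : ℕ} {Q Q' : State → Prop}

theorem Meets.mono (h : Meets P σ T Q) (hT : T ≤ T') (hQ : ∀ τ, Q τ → Q' τ) :
    Meets P σ T' Q' := by
  obtain ⟨m, τ, h1, h2, h3⟩ := h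
  exact ⟨m, τ, h1, h2.trans hT, hQ τ h3⟩

theorem Meets.frame (h : Meets P σ T Q) :
    Meets P σ T fun τ => Q τ ∧ Agree P.regs P.arrays σ τ := by
  obtain ⟨m, τ, h1, h2, h3⟩ := h
  exact ⟨m, τ, h1, h2, h3, h1.agree⟩

theorem Meets.seq (h : Meets P σ T fun τ => Meets P' τ T' Q) :
    Meets (.seq P P') σ (T + T') Q := by
  obtain ⟨m, τ, h1, h2, m', υ, h1', h2', h3⟩ := h
  exact ⟨_, υ, .seq h1 h1', add_le_add h2 h2', h3⟩

theorem Meets.skip (h : Q σ) : Meets .skip σ 0 Q := ⟨0, σ, .skip σ, le_rfl, h⟩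

theorem Meets.instr {c : Instr} (h : Q (c.apply σ)) : Meets (.instr c) σ 1 Q :=
  ⟨1, _, .instr c σ, le_rfl, h⟩

theorem Meets.ite {t : Test} (h : t.Holds σ → Meets P σ T Q) (h' : ¬ t.Holds σ → Meets P' σ T Q) :
    Meets (.ite t P P') σ (T + 1) Q := by
  by_cases ht : t.Holds σ
  · obtain ⟨m, τ, h1, h2, h3⟩ := h ht
    exact ⟨_, τ, .ite_true ht h1, by omega, h3⟩
  · obtain ⟨m, τ, h1, h2, h3⟩ := h' ht
    exact ⟨_, τ, .ite_false ht h1, by omega, h3⟩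

/-- `for x := 0 to reg y - 1 do P`. -/
def Prog.for (x y : ℕ) (P : Prog) : Prog :=
  .seq (.instr (.const x 0)) (.while (.lt x y) (.seq P (.instr (.succ x))))

/-- The rule for loops: `I k τ` is an invariant that holds after `k` rounds. -/
theorem Meets.for {x y : ℕ} {b : ℕ} (I : ℕ → State → Prop) (hy : σ.reg y = b)
    (hxP : x ∉ P.regs) (hyP : y ∉ x :: P.regs) (h0 : I 0 (σ.setReg x 0))
    (step : ∀ k < b, ∀ τ, Agree (x :: P.regs) P.arrays σ τ → τ.reg x = k → I k τ →
      Meets P τ T fun υ => I (k + 1) (υ.setReg x (k + 1)))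
    (hQ : ∀ τ, Agree (x :: P.regs) P.arrays σ τ → I b τ → Q τ) :
    Meets (.for x y P) σ (b * (T + 2) + 2) Q := by
  -- Induction on the number `d` of remaining rounds. A round costs the body, the increment and the
  -- test; the final 2 pays for the initialisation and the failing test.
  have main : ∀ d k τ, k + d = b → Agree (x :: P.regs) P.arrays σ τ → τ.reg x = k → I k τ →
      Meets (.while (.lt x y) (.seq P (.instr (.succ x)))) τ (d * (T + 2) + 1) Q := by
    intro d
    induction d with
    | zero =>
      intro k τ hk hτ hx hI
      obtain rfl : k = b := hk
      refine ⟨1, τ, .while_false ?_, by omega, hQ τ hτ hI⟩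
      simp only [Test.Holds]
      rw [hx, hτ.1 y hyP, hy]
      exact lt_irrefl _
    | succ d ih =>
      intro k τ hk hτ hx hI
      obtain ⟨m, υ, h1, h2, h3⟩ := step k (by omega) τ hτ hx hI
      have hυ : υ.reg x = k := by rw [h1.agree.1 x hxP, hx]
      have ha : Agree (x :: P.regs) P.arrays σ (υ.setReg x (k + 1)) := by
        refine (hτ.trans (h1.agree.mono (by simp) (by simp))).trans ⟨fun z hz => ?_, fun _ _ => rfl⟩
        rw [State.setReg_reg, if_neg (fun h => hz (by simp [h]))]
      obtain ⟨m', ω, h1', h2', h3'⟩ := ih (k + 1) _ (by omega) ha (by simp) h3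
      have hs : Instr.apply υ (.succ x) = υ.setReg x (k + 1) := by rw [Instr.apply, hυ]
      refine ⟨_, ω, .while_true ?_ (.seq h1 (.instr (.succ x) υ)) (hs ▸ h1'), ?_, h3'⟩
      · simp only [Test.Holds]
        rw [hx, hτ.1 y hyP, hy]
        omega
      · rw [Nat.succ_mul]; omega
  refine (Meets.seq (T := 1) (T' := b * (T + 2) + 1) (Meets.instr ?_)).mono (by omega)
    fun _ h => h
  refine main b 0 _ (by omega) ⟨fun z hz => ?_, fun _ _ => rfl⟩ (by simp [Instr.apply]) h0
  rw [Instr.apply, State.setReg_reg, if_neg (fun h => hz (by simp [h]))]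

/-- A list of instructions and programs without loops, run one after another. -/
def Prog.seqs : List Prog → Prog
  | [] => .skip
  | P :: l => .seq P (.seqs l)

/-- A bound for the number of steps of a program without loops. -/
def Prog.len : Prog → ℕ
  | .skip => 0
  | .instr _ => 1
  | .seq P Q => P.len + Q.len
  | .ite _ P Q => max P.len Q.len + 1
  | .while _ _ => 0

/-- The weakest precondition of a program without loops. -/
def Prog.wp : Prog → State → (State → Prop) → Prop
  | .skip, σ, Q => Q σ
  | .instr c, σ, Q => Q (c.apply σ)
  | .seq P P', σ, Q => P.wp σ fun τ => P'.wp τ Q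
  | .ite t P P', σ, Q => (t.Holds σ → P.wp σ Q) ∧ (¬ t.Holds σ → P'.wp σ Q)
  | .while _ _, _, _ => False

/-- The length 0 assigned to a loop is harmless, since the precondition of a loop is `False`. -/
theorem Meets.of_wp (h : P.wp σ Q) : Meets P σ P.len Q := by
  induction P generalizing σ Q with
  | skip => exact .skip h
  | instr c => exact .instr h
  | seq P P' ih ih' => exact .seq ((ih h).mono le_rfl fun _ h => ih' h)
  | ite t P P' ih ih' =>
    exact .ite (fun ht => (ih (h.1 ht)).mono (le_max_left _ _) fun _ h => h)
      fun ht => (ih' (h.2 ht)).mono (le_max_right _ _) fun _ h => h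
  | _ => exact h.elim

/-- Addition in `𝔽₂` of numbers in `{0, 1}`. -/
def bitAdd (a b : ℕ) : ℕ := if a = 1 then (if b = 1 then 0 else 1) else b

@[simp] theorem bitAdd_val (a b : ZMod 2) : bitAdd a.val b.val = (b + a).val := by
  revert a b; decide

/-- Register `y` becomes `y + x` in `𝔽₂`; register `o` holds `1`. -/
def Prog.addBit (o x y : ℕ) : Prog :=
  .ite (.eq x o) (.ite (.eq y o) (.instr (.const y 0)) (.instr (.const y 1))) .skip

theorem State.setReg_self (σ : State) (x : ℕ) : σ.setReg x (σ.reg x) = σ := by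
  simp [State.setReg]

theorem Prog.wp_addBit {o x y : ℕ} (ho : σ.reg o = 1) :
    (Prog.addBit o x y).wp σ Q ↔ Q (σ.setReg y (bitAdd (σ.reg x) (σ.reg y))) := by
  simp only [addBit, wp, Test.Holds, ho, Instr.apply, bitAdd]
  split_ifs with h1 h2 <;> simp [*, State.setReg_self]

end RAM

/-! ### Elimination of one linear equation -/

namespace RAM

/-- The parity of the product of row `0` of the array `8` and row `reg 13` of the array `7`. -/
def dotProg : Prog :=
  .seq (.instr (.const 14 0)) (.for 12 4 (.seqs
    [.instr (.load 15 8 2 12), .instr (.load 16 7 13 12),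
      .ite (.eq 15 3) (.addBit 3 16 14) .skip]))

/-- Copies row `reg 13` of the array `7` to row `0` of the array `9`. -/
def copyProg : Prog :=
  .for 12 4 (.seqs [.instr (.load 15 7 13 12), .instr (.store 9 2 12 15)])

/-- Adds row `0` of the array `9` to row `reg 13` of the array `7`. -/
def addProg : Prog :=
  .for 12 4 (.seqs [.instr (.load 15 9 2 12), .instr (.load 16 7 13 12), .addBit 3 15 16,
    .instr (.store 7 13 12 16)])

/-- Replaces the rows of the array `7` by a spanning set of those vectors in their span that are
orthogonal to row `0` of the array `8`. -/
def reduceProg : Prog :=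
  .seq (.instr (.const 17 0)) (.for 13 5 (.seq dotProg
    (.ite (.eq 14 3)
      (.seq (.ite (.eq 17 2) (.seq copyProg (.instr (.const 17 1))) .skip) addProg) .skip)))

/-- The registers that hold constants. -/
structure Consts (n l : ℕ) (σ : State) : Prop where
  reg0 : σ.reg 0 = n
  reg1 : σ.reg 1 = l
  reg2 : σ.reg 2 = 0
  reg3 : σ.reg 3 = 1
  reg4 : σ.reg 4 = 4 * n
  reg5 : σ.reg 5 = 4 * n + 1
  reg6 : σ.reg 6 = 2
  reg7 : σ.reg 7 = 3

theorem Consts.of_agree {n l : ℕ} {R A : List ℕ} {σ τ : State} (h : Consts n l σ)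
    (ha : Agree R A σ τ) (hR : ∀ x < 8, x ∉ R) : Consts n l τ where
  reg0 := by rw [ha.1 _ (hR _ (by decide)), h.reg0]
  reg1 := by rw [ha.1 _ (hR _ (by decide)), h.reg1]
  reg2 := by rw [ha.1 _ (hR _ (by decide)), h.reg2]
  reg3 := by rw [ha.1 _ (hR _ (by decide)), h.reg3]
  reg4 := by rw [ha.1 _ (hR _ (by decide)), h.reg4]
  reg5 := by rw [ha.1 _ (hR _ (by decide)), h.reg5]
  reg6 := by rw [ha.1 _ (hR _ (by decide)), h.reg6]
  reg7 := by rw [ha.1 _ (hR _ (by decide)), h.reg7]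

variable {n l : ℕ} {σ : State}

theorem dotProg_meets (h : Consts n l σ) {j : ℕ} (hj : σ.reg 13 = j) {c k : ℕ → ZMod 2}
    (hc : ∀ i < 4 * n, σ.mem 8 0 i = (c i).val) (hk : ∀ i < 4 * n, σ.mem 7 j i = (k i).val) :
    Meets dotProg σ (32 * n + 3) fun τ =>
      τ.reg 14 = (∑ i ∈ Finset.range (4 * n), c i * k i).val := by
  refine (Meets.seq (T := 1) (T' := 4 * n * (6 + 2) + 2) (.instr ?_)).mono (by omega) fun _ h => h
  refine Meets.for (fun t τ => τ.reg 14 = (∑ i ∈ Finset.range t, c i * k i).val)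
    (by simp [Instr.apply, h.reg4]) (by decide) (by decide) (by simp [Instr.apply]) ?_
    (fun τ _ h => h)
  intro t ht τ hτ htx hI
  have h2 : τ.reg 2 = 0 := by rw [hτ.1 2 (by decide)]; simp [Instr.apply, h.reg2]
  have h3 : τ.reg 3 = 1 := by rw [hτ.1 3 (by decide)]; simp [Instr.apply, h.reg3]
  have h13 : τ.reg 13 = j := by rw [hτ.1 13 (by decide)]; simp [Instr.apply, hj]
  have hm8 : τ.mem 8 = σ.mem 8 := by rw [hτ.2 8 (by decide)]; simp [Instr.apply]
  have hm7 : τ.mem 7 = σ.mem 7 := by rw [hτ.2 7 (by decide)]; simp [Instr.apply]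
  refine (Meets.of_wp ?_).mono (by decide) fun _ h => h
  rw [Finset.sum_range_succ]
  simp only [Prog.seqs, Prog.wp, Instr.apply, Test.Holds]
  rcases ZMod.eq_zero_or_eq_one_of_two (c t) with h0 | h0
  · simp [h2, h3, h13, hm8, hm7, htx, hc t ht, h0, hI]
  · simp [Prog.wp_addBit, h2, h3, h13, hm8, hm7, htx, hc t ht, hk t ht, h0, hI,
      show ZMod.val (1 : ZMod 2) = 1 from rfl]

theorem copyProg_meets (h : Consts n l σ) {j : ℕ} (hj : σ.reg 13 = j) {k : ℕ → ZMod 2}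
    (hk : ∀ i < 4 * n, σ.mem 7 j i = (k i).val) :
    Meets copyProg σ (16 * n + 2) fun τ => ∀ i < 4 * n, τ.mem 9 0 i = (k i).val := by
  refine (Meets.for (T := 2) (fun t τ => ∀ i < t, τ.mem 9 0 i = (k i).val)
    h.reg4 (by decide) (by decide) (by simp) ?_ (fun τ _ h => h)).mono (by omega) fun _ h => h
  intro t ht τ hτ htx hI
  have h2 : τ.reg 2 = 0 := by rw [hτ.1 2 (by decide), h.reg2]
  have h13 : τ.reg 13 = j := by rw [hτ.1 13 (by decide), hj]
  have hm7 : τ.mem 7 = σ.mem 7 := by rw [hτ.2 7 (by decide)]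
  refine (Meets.of_wp ?_).mono (by decide) fun _ h => h
  simp only [Prog.seqs, Prog.wp, Instr.apply]
  intro i hi
  simp only [State.setReg_mem, State.setMem_mem, State.setReg_reg]
  by_cases hit : i = t
  · subst hit; simp [h2, htx, h13, hm7, hk i ht]
  · simp [htx, hit, hI i (by omega)]

theorem addProg_meets (h : Consts n l σ) {j : ℕ} (hj : σ.reg 13 = j) {k s : ℕ → ZMod 2}
    (hk : ∀ i < 4 * n, σ.mem 7 j i = (k i).val) (hs : ∀ i < 4 * n, σ.mem 9 0 i = (s i).val) :
    Meets addProg σ (32 * n + 2) fun τ => (∀ i < 4 * n, τ.mem 7 j i = (k i + s i).val) ∧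
      ∀ j' ≠ j, τ.mem 7 j' = σ.mem 7 j' := by
  refine (Meets.for (T := 6) (fun t τ => (∀ i < 4 * n, τ.mem 7 j i =
      (if i < t then k i + s i else k i).val) ∧ ∀ j' ≠ j, τ.mem 7 j' = σ.mem 7 j')
    h.reg4 (by decide) (by decide) (by simpa using hk) ?_ (fun τ _ h => ?_)).mono (by omega)
    fun _ h => h
  · intro t ht τ hτ htx hI
    have h2 : τ.reg 2 = 0 := by rw [hτ.1 2 (by decide), h.reg2]
    have h3 : τ.reg 3 = 1 := by rw [hτ.1 3 (by decide), h.reg3]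
    have h13 : τ.reg 13 = j := by rw [hτ.1 13 (by decide), hj]
    have hm9 : τ.mem 9 = σ.mem 9 := by rw [hτ.2 9 (by decide)]
    refine (Meets.of_wp ?_).mono (by decide) fun _ h => h
    have hkt := hI.1 t ht
    rw [if_neg (lt_irrefl t)] at hkt
    simp only [Prog.seqs, Prog.wp, Instr.apply]
    rw [Prog.wp_addBit (by simp [h3])]
    refine ⟨fun i hi => ?_, fun j' hj' => ?_⟩
    · by_cases hit : i = t
      · subst hit; simp [h2, htx, h13, hm9, hkt, hs i ht]
      · have h1 : i < t + 1 ↔ i < t := by omega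
        simp [htx, hit, h1, hI.1 i hi]
    · rw [← hI.2 j' hj']
      funext i
      simp [h13, hj']
  · exact ⟨fun i hi => by rw [h.1 i hi, if_pos hi], h.2⟩

/-- The scalar product over `𝔽₂` of the first `4 n` entries. -/
def dot (n : ℕ) (c k : ℕ → ZMod 2) : ZMod 2 := ∑ i ∈ Finset.range (4 * n), c i * k i

/-- The rows of the array `7` are those of the matrix `F`. -/
def Rows (n : ℕ) (F : ℕ → ℕ → ZMod 2) (σ : State) : Prop :=
  ∀ j < 4 * n + 1, ∀ i < 4 * n, σ.mem 7 j i = (F j i).val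

/-- The first row not orthogonal to `c` is the pivot `s`. It is copied before it is added to itself,
so every row undergoes the same map `x ↦ x + (c·x) s`. Without a pivot all coefficients `c·x` are
zero and `s` is arbitrary. -/
theorem reduceProg_meets (h : Consts n l σ) {c : ℕ → ZMod 2} {F : ℕ → ℕ → ZMod 2}
    (hc : ∀ i < 4 * n, σ.mem 8 0 i = (c i).val) (hF : Rows n F σ) :
    Meets reduceProg σ ((4 * n + 1) * (80 * n + 12) + 3) fun τ => ∃ s : ℕ → ZMod 2,
      Rows n (fun j i => F j i + dot n c (F j) * s i) τ ∧
      ((∀ j < 4 * n + 1, dot n c (F j) = 0) ∨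
        ∃ p < 4 * n + 1, s = F p ∧ dot n c (F p) = 1) := by
  refine (Meets.seq (T := 1) (T' := (4 * n + 1) * (80 * n + 10 + 2) + 2) (.instr ?_)).mono
    (le_of_eq (by ring)) fun _ h => h
  -- Register `17` records whether a pivot has been found. Until then `s` is a dummy, and the
  -- contents of the array `9` do not matter.
  refine Meets.for (fun t τ => ∃ s : ℕ → ZMod 2,
      Rows n (fun j i => F j i + (if j < t then dot n c (F j) else 0) * s i) τ ∧
      ((τ.reg 17 = 0 ∧ ∀ j < t, dot n c (F j) = 0) ∨
        (τ.reg 17 = 1 ∧ (∀ i < 4 * n, τ.mem 9 0 i = (s i).val) ∧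
          ∃ p < t, s = F p ∧ dot n c (F p) = 1)))
    (by simp [Instr.apply, h.reg5]) (by decide) (by decide) ?_ ?_ ?_
  · exact ⟨0, by simpa [Rows, Instr.apply] using hF, Or.inl ⟨by simp [Instr.apply], by simp⟩⟩
  · rintro t ht τ hτ htx ⟨s, hR, hs⟩
    have hC : Consts n l τ := by
      refine Consts.of_agree (σ := Instr.apply σ (.const 17 0)) ?_ hτ (by decide)
      constructor <;> simp [Instr.apply, h.reg0, h.reg1, h.reg2, h.reg3, h.reg4, h.reg5, h.reg6,
        h.reg7]
    have hc' : ∀ i < 4 * n, τ.mem 8 0 i = (c i).val := by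
      intro i hi
      rw [hτ.2 8 (by decide)]
      simpa [Instr.apply] using hc i hi
    have hk : ∀ i < 4 * n, τ.mem 7 t i = (F t i).val := by
      intro i hi
      simpa using hR t ht i hi
    refine (Meets.seq (T := 32 * n + 3) (T' := 48 * n + 7)
      ((dotProg_meets hC htx hc' hk).frame.mono le_rfl ?_)).mono (by omega) fun _ h => h
    rintro υ ⟨hd, hυ⟩
    change υ.reg 14 = (dot n c (F t)).val at hd
    have hCυ : Consts n l υ := hC.of_agree hυ (by decide)
    have hυ7 : υ.mem 7 = τ.mem 7 := hυ.2 7 (by decide)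
    have hυ9 : υ.mem 9 = τ.mem 9 := hυ.2 9 (by decide)
    have hυ13 : υ.reg 13 = t := by rw [hυ.1 13 (by decide), htx]
    have hυ17 : υ.reg 17 = τ.reg 17 := hυ.1 17 (by decide)
    refine (Meets.ite (T := 48 * n + 6) ?_ ?_).mono (by omega) fun _ h => h
    · intro ht1
      have hd1 : dot n c (F t) = 1 := by
        have h1 : υ.reg 14 = υ.reg 3 := ht1
        rw [hd, hCυ.reg3] at h1
        exact (ZMod.eq_zero_or_eq_one_of_two _).resolve_left fun h0 => by simp [h0] at h1
      -- This covers both a pivot just copied and an older one: replacing `s` by `s'` is harmless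
      -- where the earlier products are zero.
      have hfin : ∀ ω, Consts n l ω → ω.mem 7 = τ.mem 7 → ω.reg 13 = t → ω.reg 17 = 1 →
          (∃ s', (∀ i < 4 * n, ω.mem 9 0 i = (s' i).val) ∧
            (∀ j < t, dot n c (F j) = 0 ∨ s' = s) ∧
            ∃ p < t + 1, s' = F p ∧ dot n c (F p) = 1) →
          Meets addProg ω (32 * n + 2) fun υ => ∃ s : ℕ → ZMod 2,
            Rows n (fun j i => F j i + (if j < t + 1 then dot n c (F j) else 0) * s i)
              (υ.setReg 13 (t + 1)) ∧
            (((υ.setReg 13 (t + 1)).reg 17 = 0 ∧ ∀ j < t + 1, dot n c (F j) = 0) ∨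
              ((υ.setReg 13 (t + 1)).reg 17 = 1 ∧
                (∀ i < 4 * n, (υ.setReg 13 (t + 1)).mem 9 0 i = (s i).val) ∧
                ∃ p < t + 1, s = F p ∧ dot n c (F p) = 1)) := by
        rintro ω hω h7 h13 h17 ⟨s', h9, hss, hp⟩
        refine (addProg_meets hω h13 (k := F t) (s := s') (by rwa [h7]) h9).frame.mono le_rfl ?_
        rintro ξ ⟨⟨ha, hb⟩, hξ⟩
        refine ⟨s', fun j hj i hi => ?_, Or.inr ⟨?_, ?_, hp⟩⟩
        · rw [State.setReg_mem]
          by_cases hjt : j = t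
          · subst hjt
            simp [ha i hi, hd1]
          · rw [hb j hjt, h7, hR j hj i hi]
            have h1 : j < t + 1 ↔ j < t := by omega
            by_cases hlt : j < t
            · rcases hss j hlt with h0 | h0
              · simp [h0]
              · rw [h0]; simp [h1]
            · simp [h1, hlt]
        · rw [State.setReg_reg, if_neg (by decide), hξ.1 17 (by decide), h17]
        · rw [State.setReg_mem, hξ.2 9 (by decide)]; exact h9
      refine (Meets.seq (T := 16 * n + 4) (T' := 32 * n + 2) ?_).mono (by omega) fun _ h => h
      refine (Meets.ite (T := 16 * n + 3) ?_ ?_).mono (by omega) fun _ h => h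
      · intro h17
        have h17 : υ.reg 17 = υ.reg 2 := h17
        rw [hCυ.reg2, hυ17] at h17
        refine Meets.seq (T := 16 * n + 2) (T' := 1)
          ((copyProg_meets hCυ hυ13 (k := F t) (by rwa [hυ7])).frame.mono le_rfl ?_)
        rintro ω ⟨h9, hω⟩
        refine .instr (hfin _ ?_ ?_ ?_ ?_ ⟨F t, ?_, ?_, t, by omega, rfl, hd1⟩)
        · have := hCυ.of_agree hω (by decide)
          constructor <;> simp [Instr.apply, this.reg0, this.reg1, this.reg2, this.reg3, this.reg4,
            this.reg5, this.reg6, this.reg7]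
        · change ω.mem 7 = _; rw [hω.2 7 (by decide), hυ7]
        · simp [Instr.apply, hω.1 13 (by decide), hυ13]
        · simp [Instr.apply]
        · exact h9
        · intro j hj
          rcases hs with hs | hs
          · left; exact hs.2 j hj
          · omega
      · intro h17
        refine (Meets.skip ?_).mono (Nat.zero_le _) fun _ h => h
        have h17 : ¬ υ.reg 17 = υ.reg 2 := h17
        rw [hCυ.reg2, hυ17] at h17
        rcases hs with hs | ⟨hs1, hs2, p, hp, hs3⟩
        · exact absurd hs.1 h17
        · exact hfin υ hCυ hυ7 hυ13 (hυ17.trans hs1) ⟨s, by rwa [hυ9], fun _ _ => Or.inr rfl,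
            p, by omega, hs3⟩
    · intro ht1
      have hd0 : dot n c (F t) = 0 := by
        have h1 : ¬ υ.reg 14 = υ.reg 3 := ht1
        rw [hd, hCυ.reg3] at h1
        refine (ZMod.eq_zero_or_eq_one_of_two _).resolve_right fun h0 => h1 ?_
        rw [h0]; rfl
      refine (Meets.skip ?_).mono (Nat.zero_le _) fun _ h => h
      refine ⟨s, fun j hj i hi => ?_, ?_⟩
      · rw [State.setReg_mem, hυ7, hR j hj i hi]
        by_cases hjt : j = t
        · subst hjt; simp [hd0]
        · have h1 : j < t + 1 ↔ j < t := by omega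
          simp only [h1]
      · rw [State.setReg_reg, if_neg (by decide), hυ17, State.setReg_mem, hυ9]
        rcases hs with hs | ⟨hs1, hs2, p, hp, hs3⟩
        · refine Or.inl ⟨hs.1, fun j hj => ?_⟩
          rcases Nat.lt_succ_iff_lt_or_eq.1 hj with h1 | rfl
          · exact hs.2 j h1
          · exact hd0
        · exact Or.inr ⟨hs1, hs2, p, by omega, hs3⟩
  · rintro τ - ⟨s, hR, hs⟩
    refine ⟨s, fun j hj i hi => ?_, ?_⟩
    · simp [hR j hj i hi, hj]
    · rcases hs with hs | hs
      · exact Or.inl hs.2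
      · exact Or.inr hs.2.2

end RAM

/-! ### Writing the equations as rows of coefficients -/

namespace RAM

/-- The vector whose entries with index `4 * w + s` are those of `c s`. -/
def interleave (c : Fin 4 → ℕ → ZMod 2) (i : ℕ) : ZMod 2 := c (Fin.ofNat 4 i) (i / 4)

theorem interleave_apply (c : Fin 4 → ℕ → ZMod 2) (w : ℕ) (s : Fin 4) :
    interleave c (4 * w + s) = c s w := by
  have h1 : (4 * w + (s : ℕ)) / 4 = w := by omega
  have h2 : Fin.ofNat 4 (4 * w + (s : ℕ)) = s := by
    ext; simp only [Fin.ofNat]; omega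
  rw [interleave, h1, h2]

/-- The coefficients are written in blocks of four, one block per vertex, so this is the induction
step of both writing loops. -/
theorem eq_interleave_succ {c : Fin 4 → ℕ → ZMod 2} {m : ℕ → ℕ} {w : ℕ}
    (h : ∀ i < 4 * w, m i = (interleave c i).val) (hw : ∀ s : Fin 4, m (4 * w + s) = (c s w).val) :
    ∀ i < 4 * (w + 1), m i = (interleave c i).val := by
  intro i hi
  by_cases hlt : i < 4 * w
  · exact h i hlt
  · obtain ⟨s, rfl⟩ : ∃ s : Fin 4, i = 4 * w + s :=
      ⟨⟨i - 4 * w, by omega⟩, by simp only; omega⟩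
    rw [hw, interleave_apply]

/-- The coefficients of the equation (i) for `u` and `v`, the adjacency matrices being `g` and
`h`. -/
def coeffs (g h : ℕ → ℕ → ZMod 2) (u v : ℕ) : Fin 4 → ℕ → ZMod 2 :=
  ![fun w => if w = v then g u w else 0, fun w => g u w * h v w,
    fun w => if w = u then (if w = v then 1 else 0) else 0, fun w => if w = u then h v w else 0]

/-- Register `x` becomes `reg a` if the test succeeds, and `reg b` otherwise. -/
def Prog.select (t : Test) (x a b : ℕ) : Prog := .ite t (.instr (.copy x a)) (.instr (.copy x b))

open scoped Classical in
theorem Prog.wp_select {t : Test} {x a b : ℕ} {σ : State} {Q : State → Prop} :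
    (Prog.select t x a b).wp σ Q ↔
      Q (σ.setReg x (if t.Holds σ then σ.reg a else σ.reg b)) := by
  simp only [select, wp, Instr.apply]
  split_ifs with h <;> simp [h]

/-- Writes to row `0` of the array `8` the equation (i) for `u = reg 8` and `v = reg 9`. -/
def equationProg : Prog :=
  .seq (.instr (.const 12 0)) (.for 11 0 (.seqs
    [.instr (.load 15 0 8 11), .instr (.load 16 1 9 11),
      .select (.eq 11 9) 14 15 2, .instr (.store 8 2 12 14), .instr (.succ 12),
      .select (.eq 15 3) 14 16 2, .instr (.store 8 2 12 14), .instr (.succ 12),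
      .select (.eq 11 9) 14 3 2, .select (.eq 11 8) 14 14 2, .instr (.store 8 2 12 14),
      .instr (.succ 12),
      .select (.eq 11 8) 14 16 2, .instr (.store 8 2 12 14), .instr (.succ 12)]))

/-- Writes to row `0` of the array `8` the constraint with number `reg 10`. -/
def constraintProg : Prog :=
  .seq (.instr (.const 12 0)) (.for 11 0 (.seqs
    [.instr (.load 15 2 10 11), .instr (.store 8 2 12 15), .instr (.succ 12),
      .instr (.load 15 3 10 11), .instr (.store 8 2 12 15), .instr (.succ 12),
      .instr (.load 15 4 10 11), .instr (.store 8 2 12 15), .instr (.succ 12),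
      .instr (.load 15 5 10 11), .instr (.store 8 2 12 15), .instr (.succ 12)]))

theorem Consts.setReg {n l : ℕ} {σ : State} (h : Consts n l σ) {x : ℕ} (hx : 8 ≤ x) (k : ℕ) :
    Consts n l (σ.setReg x k) :=
  h.of_agree (R := [x]) (A := []) ⟨fun y hy => by simp at hy; simp [hy], fun _ _ => rfl⟩
    fun y hy => by simp; omega

theorem ZMod.val_one_two : ZMod.val (1 : ZMod 2) = 1 := rfl

variable {n l : ℕ} {σ : State}

theorem equationProg_meets (hC : Consts n l σ) {u v : ℕ} (hu : σ.reg 8 = u) (hv : σ.reg 9 = v)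
    {g h : ℕ → ℕ → ZMod 2} (hg : ∀ w, σ.mem 0 u w = (g u w).val)
    (hh : ∀ w, σ.mem 1 v w = (h v w).val) :
    Meets equationProg σ (22 * n + 3) fun τ =>
      ∀ i < 4 * n, τ.mem 8 0 i = (interleave (coeffs g h u v) i).val := by
  refine (Meets.seq (T := 1) (T' := n * (20 + 2) + 2) (.instr ?_)).mono (by omega) fun _ h => h
  refine Meets.for (fun t τ => τ.reg 12 = 4 * t ∧
      ∀ i < 4 * t, τ.mem 8 0 i = (interleave (coeffs g h u v) i).val)
    (by simp [Instr.apply, hC.reg0]) (by decide) (by decide) (by simp [Instr.apply]) ?_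
    (fun τ _ h => h.2)
  rintro t ht τ hτ htx ⟨h12, hI⟩
  have hC' : Consts n l τ := (hC.setReg (x := 12) (by decide) 0).of_agree hτ (by decide)
  have h8 : τ.reg 8 = u := by rw [hτ.1 8 (by decide)]; simp [Instr.apply, hu]
  have h9 : τ.reg 9 = v := by rw [hτ.1 9 (by decide)]; simp [Instr.apply, hv]
  have hm0 : τ.mem 0 = σ.mem 0 := by rw [hτ.2 0 (by decide)]; simp [Instr.apply]
  have hm1 : τ.mem 1 = σ.mem 1 := by rw [hτ.2 1 (by decide)]; simp [Instr.apply]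
  refine (Meets.of_wp (Q := fun υ => υ.reg 12 = 4 * (t + 1) ∧ (∀ i < 4 * t,
    υ.mem 8 0 i = τ.mem 8 0 i) ∧ ∀ s : Fin 4, υ.mem 8 0 (4 * t + s) = (coeffs g h u v s t).val)
    ?_).mono (by decide) ?_
  · have key : (∀ i < 4 * t, i ≠ 4 * t ∧ i ≠ 4 * t + 1 ∧ i ≠ 4 * t + 1 + 1 ∧
        i ≠ 4 * t + 1 + 1 + 1) := by omega
    simp only [Prog.seqs, Prog.wp, Prog.wp_select, Instr.apply, Test.Holds]
    refine ⟨by simp [h12]; omega, fun i hi => ?_, ?_⟩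
    · have := key i hi
      simp [h12, this]
    · simp [Fin.forall_fin_succ, coeffs, hC'.reg2, hC'.reg3, h8, h9, hm0, hm1, htx, h12, hg, hh]
      rw [if_neg (by omega), if_neg (by omega)]
      refine ⟨by split_ifs <;> rfl, ?_, by split_ifs <;> rfl, by split_ifs <;> rfl⟩
      -- The second coefficient is a product, computed by a test on its first factor.
      rcases ZMod.eq_zero_or_eq_one_of_two (g u t) with h0 | h0 <;> simp [h0, ZMod.val_one_two]
  · rintro υ ⟨h1, h2, h3⟩
    refine ⟨by simpa using h1, eq_interleave_succ (fun i hi => ?_) h3⟩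
    rw [State.setReg_mem, h2 i hi, hI i hi]

theorem constraintProg_meets (hC : Consts n l σ) {e : ℕ} (he : σ.reg 10 = e)
    {c : Fin 4 → ℕ → ZMod 2} (h0 : ∀ w, σ.mem 2 e w = (c 0 w).val)
    (h1 : ∀ w, σ.mem 3 e w = (c 1 w).val) (h2 : ∀ w, σ.mem 4 e w = (c 2 w).val)
    (h3 : ∀ w, σ.mem 5 e w = (c 3 w).val) :
    Meets constraintProg σ (14 * n + 3) fun τ =>
      ∀ i < 4 * n, τ.mem 8 0 i = (interleave c i).val := by
  refine (Meets.seq (T := 1) (T' := n * (12 + 2) + 2) (.instr ?_)).mono (by omega) fun _ h => h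
  refine Meets.for (fun t τ => τ.reg 12 = 4 * t ∧
      ∀ i < 4 * t, τ.mem 8 0 i = (interleave c i).val)
    (by simp [Instr.apply, hC.reg0]) (by decide) (by decide) (by simp [Instr.apply]) ?_
    (fun τ _ h => h.2)
  rintro t ht τ hτ htx ⟨h12, hI⟩
  have hC' : Consts n l τ := (hC.setReg (x := 12) (by decide) 0).of_agree hτ (by decide)
  have h10 : τ.reg 10 = e := by rw [hτ.1 10 (by decide)]; simp [Instr.apply, he]
  have hm2 : τ.mem 2 = σ.mem 2 := by rw [hτ.2 2 (by decide)]; simp [Instr.apply]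
  have hm3 : τ.mem 3 = σ.mem 3 := by rw [hτ.2 3 (by decide)]; simp [Instr.apply]
  have hm4 : τ.mem 4 = σ.mem 4 := by rw [hτ.2 4 (by decide)]; simp [Instr.apply]
  have hm5 : τ.mem 5 = σ.mem 5 := by rw [hτ.2 5 (by decide)]; simp [Instr.apply]
  refine (Meets.of_wp (Q := fun υ => υ.reg 12 = 4 * (t + 1) ∧ (∀ i < 4 * t,
    υ.mem 8 0 i = τ.mem 8 0 i) ∧ ∀ s : Fin 4, υ.mem 8 0 (4 * t + s) = (c s t).val)
    ?_).mono (by decide) ?_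
  · have key : (∀ i < 4 * t, i ≠ 4 * t ∧ i ≠ 4 * t + 1 ∧ i ≠ 4 * t + 1 + 1 ∧
        i ≠ 4 * t + 1 + 1 + 1) := by omega
    simp only [Prog.seqs, Prog.wp, Instr.apply]
    refine ⟨by simp [h12]; omega, fun i hi => ?_, ?_⟩
    · have := key i hi
      simp [h12, this]
    · simp [Fin.forall_fin_succ, hC'.reg2, h10, hm2, hm3, hm4, hm5, htx, h12, h0, h1, h2, h3]
      rw [if_neg (by omega), if_neg (by omega)]
  · rintro υ ⟨h1, h2, h3⟩
    refine ⟨by simpa using h1, eq_interleave_succ (fun i hi => ?_) h3⟩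
    rw [State.setReg_mem, h2 i hi, hI i hi]

end RAM

/-! ### Initialisation, search and output -/

namespace RAM

/-- Sets the constants, and the rows of the array `7` to the standard basis and a zero row. -/
def setupProg : Prog :=
  .seqs [.instr (.const 2 0), .instr (.const 3 1), .instr (.const 6 2), .instr (.const 7 3),
    .instr (.const 4 0),
    .for 11 0 (.seqs [.instr (.succ 4), .instr (.succ 4), .instr (.succ 4), .instr (.succ 4)]),
    .instr (.copy 5 4), .instr (.succ 5), .for 13 4 (.instr (.store 7 13 13 3))]

/-- Adds the entries `reg 12` of the rows `reg 18` and `reg 19` of the array `7`, in register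
`x`. -/
def addEntries (x : ℕ) : Prog :=
  .seqs [.instr (.load 15 7 19 12), .instr (.load x 7 18 12), .addBit 3 15 x, .instr (.succ 12)]

/-- Sets register `20` to `1` if the sum of the rows `reg 18` and `reg 19` of the array `7`
satisfies (ii), and to `0` otherwise. -/
def checkProg : Prog :=
  .seqs [.instr (.const 20 1), .instr (.const 12 0), .for 11 0 (.seqs
    [addEntries 24, addEntries 25, addEntries 26, addEntries 27, .instr (.const 14 0),
      .ite (.eq 24 3) (.addBit 3 27 14) .skip, .ite (.eq 25 3) (.addBit 3 26 14) .skip,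
      .select (.eq 14 2) 20 2 20])]

/-- Looks for two rows of the array `7` whose sum satisfies (ii). -/
def searchProg : Prog :=
  .seq (.instr (.const 21 0)) (.for 18 5 (.for 19 5 (.seq checkProg
    (.ite (.eq 20 3) (.seqs [.instr (.const 21 1), .instr (.copy 22 18), .instr (.copy 23 19)])
      .skip))))

/-- Writes the sum of the rows `reg 22` and `reg 23` of the array `7` to the array `6`. -/
def outputProg : Prog :=
  .seq (.instr (.const 12 0)) (.for 11 0 (.seqs
    [.instr (.load 15 7 23 12), .instr (.load 16 7 22 12), .addBit 3 15 16,
      .instr (.store 6 2 11 16), .instr (.succ 12),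
      .instr (.load 15 7 23 12), .instr (.load 16 7 22 12), .addBit 3 15 16,
      .instr (.store 6 3 11 16), .instr (.succ 12),
      .instr (.load 15 7 23 12), .instr (.load 16 7 22 12), .addBit 3 15 16,
      .instr (.store 6 6 11 16), .instr (.succ 12),
      .instr (.load 15 7 23 12), .instr (.load 16 7 22 12), .addBit 3 15 16,
      .instr (.store 6 7 11 16), .instr (.succ 12)]))

variable {n l : ℕ} {σ : State}

theorem setupProg_meets (h0 : σ.reg 0 = n) (h1 : σ.reg 1 = l) (h7 : ∀ i j, σ.mem 7 i j = 0) :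
    Meets setupProg σ (18 * n + 11) fun τ => Consts n l τ ∧
      Rows n (fun j i => if j = i then 1 else 0) τ := by
  let σ' := ((((σ.setReg 2 0).setReg 3 1).setReg 6 2).setReg 7 3).setReg 4 0
  have hloop : Meets (.for 11 0 (.seqs [.instr (.succ 4), .instr (.succ 4), .instr (.succ 4),
      .instr (.succ 4)])) σ' (n * 6 + 2) fun τ => τ.reg 4 = 4 * n := by
    refine Meets.for (T := 4) (fun t τ => τ.reg 4 = 4 * t) (by simp [σ', h0]) (by decide)
      (by decide) (by simp [σ']) ?_ (fun τ _ h => h)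
    intro t ht τ hτ htx hI
    refine (Meets.of_wp ?_).mono (by decide) fun _ h => h
    simp [Prog.seqs, Prog.wp, Instr.apply, hI]
    omega
  refine (Meets.seq (T := 1) (T' := 18 * n + 10) (.instr ?_)).mono (by omega) fun _ h => h
  refine (Meets.seq (T := 1) (T' := 18 * n + 9) (.instr ?_)).mono (by omega) fun _ h => h
  refine (Meets.seq (T := 1) (T' := 18 * n + 8) (.instr ?_)).mono (by omega) fun _ h => h
  refine (Meets.seq (T := 1) (T' := 18 * n + 7) (.instr ?_)).mono (by omega) fun _ h => h
  refine (Meets.seq (T := 1) (T' := 18 * n + 6) (.instr ?_)).mono (by omega) fun _ h => h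
  refine (Meets.seq (T := n * 6 + 2) (T' := 12 * n + 4) (hloop.frame.mono le_rfl ?_)).mono
    (by omega) fun _ h => h
  rintro τ ⟨h4, hτ⟩
  refine (Meets.seq (T := 1) (T' := 12 * n + 3) (.instr ?_)).mono (by omega) fun _ h => h
  refine (Meets.seq (T := 1) (T' := 12 * n + 2) (.instr ?_)).mono (by omega) fun _ h => h
  have hC : Consts n l (Instr.apply (Instr.apply τ (.copy 5 4)) (.succ 5)) := by
    have e0 : τ.reg 0 = n := by rw [hτ.1 0 (by decide)]; simp [σ', h0]
    have e1 : τ.reg 1 = l := by rw [hτ.1 1 (by decide)]; simp [σ', h1]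
    have e2 : τ.reg 2 = 0 := by rw [hτ.1 2 (by decide)]; simp [σ']
    have e3 : τ.reg 3 = 1 := by rw [hτ.1 3 (by decide)]; simp [σ']
    have e6 : τ.reg 6 = 2 := by rw [hτ.1 6 (by decide)]; simp [σ']
    have e7 : τ.reg 7 = 3 := by rw [hτ.1 7 (by decide)]; simp [σ']
    constructor <;> simp [Instr.apply, *]
  have h7' : ∀ i j, (Instr.apply (Instr.apply τ (.copy 5 4)) (.succ 5)).mem 7 i j = 0 := by
    intro i j
    simp only [Instr.apply, State.setReg_mem]
    rw [hτ.2 7 (by decide)]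
    exact h7 i j
  generalize Instr.apply (Instr.apply τ (.copy 5 4)) (.succ 5) = υ at hC h7' ⊢
  refine (Meets.seq (T := 12 * n + 2) (T' := 0) ?_)
  -- The diagonal is filled only in the first `4n` rows, so the last of the `4n + 1` rows keeps its
  -- initial zeros.
  refine (Meets.for (T := 1) (fun t τ => ∀ j i, τ.mem 7 j i = if j < t ∧ j = i then 1 else 0)
    hC.reg4 (by decide) (by decide) (by simpa using h7') ?_ ?_).mono (by omega) fun _ h => h
  · intro t ht ω hω htx hI
    refine .instr fun j i => ?_
    have e3 : ω.reg 3 = 1 := by rw [hω.1 3 (by decide), hC.reg3]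
    simp only [Instr.apply, State.setReg_mem, State.setMem_mem, htx, e3, hI, true_and]
    split_ifs <;> first | rfl | omega
  · intro ω hω hI
    refine .skip ⟨hC.of_agree hω (by decide), fun j hj i hi => ?_⟩
    rw [hI]
    by_cases hji : j = i
    · simp [hji, hi, ZMod.val_one_two]
    · simp [hji]

/-- The determinant with number `w` of the quadruple whose entries are listed in `x`. -/
def det (x : ℕ → ZMod 2) (w : ℕ) : ZMod 2 :=
  x (4 * w) * x (4 * w + 3) + x (4 * w + 1) * x (4 * w + 2)

theorem wp_addEntries {x : ℕ} (hx : 24 ≤ x) {Q : State → Prop} {a b : ZMod 2} {i : ℕ}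
    (h3 : σ.reg 3 = 1) (hi : σ.reg 12 = i) (ha : σ.mem 7 (σ.reg 18) i = a.val)
    (hb : σ.mem 7 (σ.reg 19) i = b.val)
    (h : Q (((σ.setReg 15 b.val).setReg x (a + b).val).setReg 12 (i + 1))) :
    (addEntries x).wp σ Q := by
  have e1 : (18 : ℕ) ≠ 15 := by decide
  have e2 : 12 ≠ x := by omega
  have e3 : 15 ≠ x := by omega
  have e4 : 3 ≠ x := by omega
  simp only [addEntries, Prog.seqs, Prog.wp, Instr.apply]
  rw [Prog.wp_addBit (by simp [h3, e4])]
  convert h using 1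
  ext y
  · simp only [State.setReg_reg, State.setReg_mem, hi, hb, if_true, if_neg e2, if_neg e3,
      if_neg e1]
    split_ifs <;> first | rfl | simp_all
  · simp

theorem checkProg_meets (hC : Consts n l σ) {f g : ℕ} (hf : σ.reg 18 = f) (hg : σ.reg 19 = g)
    {F : ℕ → ℕ → ZMod 2} (hF : Rows n F σ) (hf' : f < 4 * n + 1) (hg' : g < 4 * n + 1) :
    Meets checkProg σ (37 * n + 4) fun τ =>
      (τ.reg 20 = 1 ∧ ∀ w < n, det (F f + F g) w = 1) ∨
      (τ.reg 20 = 0 ∧ ¬ ∀ w < n, det (F f + F g) w = 1) := by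
  refine (Meets.seq (T := 1) (T' := 37 * n + 3) (.instr ?_)).mono (by omega) fun _ h => h
  refine (Meets.seq (T := 1) (T' := 37 * n + 2) (.instr ?_)).mono (by omega) fun _ h => h
  have hC0 := (hC.setReg (x := 20) (by decide) 1).setReg (x := 12) (by decide) 0
  refine (Meets.seq (T := n * (35 + 2) + 2) (T' := 0) ?_).mono (by omega) fun _ h => h
  refine (Meets.for (fun t τ => τ.reg 12 = 4 * t ∧
      ((τ.reg 20 = 1 ∧ ∀ w < t, det (F f + F g) w = 1) ∨
      (τ.reg 20 = 0 ∧ ¬ ∀ w < t, det (F f + F g) w = 1))) hC0.reg0 (by decide) (by decide)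
    (by simp [Instr.apply]) ?_ fun τ _ h => .skip h.2)
  rintro t ht τ hτ htx ⟨h12, hI⟩
  have hC' : Consts n l τ := hC0.of_agree hτ (by decide)
  have h18 : τ.reg 18 = f := by rw [hτ.1 18 (by decide)]; simp [Instr.apply, hf]
  have h19 : τ.reg 19 = g := by rw [hτ.1 19 (by decide)]; simp [Instr.apply, hg]
  have hm : Rows n F τ := by
    intro j hj i hi
    rw [hτ.2 7 (by decide)]
    exact hF j hj i hi
  have hrow : ∀ i < 4 * n, τ.mem 7 f i = (F f i).val ∧ τ.mem 7 g i = (F g i).val :=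
    fun i hi => ⟨hm f hf' i hi, hm g hg' i hi⟩
  have e0 := hrow (4 * t) (by omega)
  have e1 := hrow (4 * t + 1) (by omega)
  have e2 := hrow (4 * t + 1 + 1) (by omega)
  have e3 := hrow (4 * t + 1 + 1 + 1) (by omega)
  refine (Meets.of_wp ?_).mono (by decide) fun _ h => h
  rw [Prog.seqs, Prog.wp]
  refine wp_addEntries (i := 4 * t) (a := F f (4 * t)) (b := F g (4 * t)) (by decide)
    (by simp [hC'.reg3]) (by simp [h12]) (by simp [h18, e0]) (by simp [h19, e0]) ?_
  rw [Prog.seqs, Prog.wp]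
  refine wp_addEntries (i := 4 * t + 1) (a := F f (4 * t + 1)) (b := F g (4 * t + 1)) (by decide)
    (by simp [hC'.reg3]) (by simp) (by simp [h18, e1]) (by simp [h19, e1]) ?_
  rw [Prog.seqs, Prog.wp]
  refine wp_addEntries (i := 4 * t + 1 + 1) (a := F f (4 * t + 1 + 1)) (b := F g (4 * t + 1 + 1))
    (by decide) (by simp [hC'.reg3]) (by simp) (by simp [h18, e2]) (by simp [h19, e2]) ?_
  rw [Prog.seqs, Prog.wp]
  refine wp_addEntries (i := 4 * t + 1 + 1 + 1) (a := F f (4 * t + 1 + 1 + 1))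
    (b := F g (4 * t + 1 + 1 + 1)) (by decide) (by simp [hC'.reg3]) (by simp)
    (by simp [h18, e3]) (by simp [h19, e3]) ?_
  have hall : (∀ w < t + 1, det (F f + F g) w = 1) ↔
      (∀ w < t, det (F f + F g) w = 1) ∧ det (F f + F g) t = 1 := by
    constructor
    · exact fun h => ⟨fun w hw => h w (by omega), h t (by omega)⟩
    · rintro ⟨h1, h2⟩ w hw
      rcases Nat.lt_succ_iff_lt_or_eq.1 hw with h3 | rfl
      · exact h1 w h3
      · exact h2
  rw [hall]
  have hdet : det (F f + F g) t = (F f (4 * t) + F g (4 * t)) *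
      (F f (4 * t + 1 + 1 + 1) + F g (4 * t + 1 + 1 + 1)) + (F f (4 * t + 1) + F g (4 * t + 1)) *
      (F f (4 * t + 1 + 1) + F g (4 * t + 1 + 1)) := rfl
  rw [hdet]
  generalize (∀ w < t, det (F f + F g) w = 1) = p at hI ⊢
  generalize F f (4 * t) + F g (4 * t) = x₀
  generalize F f (4 * t + 1) + F g (4 * t + 1) = x₁
  generalize F f (4 * t + 1 + 1) + F g (4 * t + 1 + 1) = x₂
  generalize F f (4 * t + 1 + 1 + 1) + F g (4 * t + 1 + 1 + 1) = x₃
  have h4 : 4 * t + 1 + 1 + 1 + 1 = 4 * (t + 1) := by omega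
  simp only [Prog.seqs, Prog.wp, Prog.wp_select, Test.Holds, Instr.apply]
  rcases ZMod.eq_zero_or_eq_one_of_two x₀ with rfl | rfl <;>
  rcases ZMod.eq_zero_or_eq_one_of_two x₁ with rfl | rfl <;>
  rcases ZMod.eq_zero_or_eq_one_of_two x₂ with rfl | rfl <;>
  rcases ZMod.eq_zero_or_eq_one_of_two x₃ with rfl | rfl <;>
  rcases hI with ⟨h1, h2⟩ | ⟨h1, h2⟩ <;>
  simp [hC'.reg3, hC'.reg2, ZMod.val_one_two, Prog.wp_addBit, h4, bitAdd, h1, h2,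
    show (1 : ZMod 2) + 1 = 0 from rfl]

/-- There is no early exit: a later success overwrites the recorded pair, and any recorded pair is
valid. The total stays cubic. -/
theorem searchProg_meets (hC : Consts n l σ) {F : ℕ → ℕ → ZMod 2} (hF : Rows n F σ) :
    Meets searchProg σ ((4 * n + 1) * ((4 * n + 1) * (37 * n + 10) + 4) + 3) fun τ =>
      (τ.reg 21 = 0 ∧ ∀ f < 4 * n + 1, ∀ g < 4 * n + 1, ¬ ∀ w < n, det (F f + F g) w = 1) ∨
      (τ.reg 21 = 1 ∧ ∃ f < 4 * n + 1, ∃ g < 4 * n + 1, τ.reg 22 = f ∧ τ.reg 23 = g ∧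
        ∀ w < n, det (F f + F g) w = 1) := by
  refine (Meets.seq (T := 1) (T' := (4 * n + 1) * ((4 * n + 1) * (37 * n + 10) + 4) + 2)
    (.instr ?_)).mono (by omega) fun _ h => h
  have hC0 := hC.setReg (x := 21) (by decide) 0
  refine (Meets.for (T := (4 * n + 1) * (37 * n + 8 + 2) + 2) (fun t τ =>
      (τ.reg 21 = 0 ∧ ∀ f < t, ∀ g < 4 * n + 1, ¬ ∀ w < n, det (F f + F g) w = 1) ∨
      (τ.reg 21 = 1 ∧ ∃ f < 4 * n + 1, ∃ g < 4 * n + 1, τ.reg 22 = f ∧ τ.reg 23 = g ∧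
        ∀ w < n, det (F f + F g) w = 1)) hC0.reg5 (by decide) (by decide)
    (by simp) ?_ fun τ _ h => h).mono le_rfl fun _ h => h
  intro t ht τ hτ htx hI
  have hC1 : Consts n l τ := hC0.of_agree hτ (by decide)
  have hF1 : Rows n F τ := by
    intro j hj i hi
    rw [hτ.2 7 (by decide)]
    exact hF j hj i hi
  refine Meets.for (T := 37 * n + 8) (fun t' τ =>
      (τ.reg 21 = 0 ∧ (∀ f < t, ∀ g < 4 * n + 1, ¬ ∀ w < n, det (F f + F g) w = 1) ∧
        ∀ g < t', ¬ ∀ w < n, det (F t + F g) w = 1) ∨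
      (τ.reg 21 = 1 ∧ ∃ f < 4 * n + 1, ∃ g < 4 * n + 1, τ.reg 22 = f ∧ τ.reg 23 = g ∧
        ∀ w < n, det (F f + F g) w = 1)) hC1.reg5 (by decide) (by decide) (by simpa using hI) ?_ ?_
  · intro t' ht' υ hυ htx' hI'
    have hC2 : Consts n l υ := hC1.of_agree hυ (by decide)
    have h18 : υ.reg 18 = t := by rw [hυ.1 18 (by decide), htx]
    have hF2 : Rows n F υ := by
      intro j hj i hi
      rw [hυ.2 7 (by decide)]
      exact hF1 j hj i hi
    refine (Meets.seq (T := 37 * n + 4) (T' := 4)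
      ((checkProg_meets hC2 h18 htx' hF2 ht ht').frame.mono le_rfl ?_)).mono (by omega) fun _ h => h
    rintro ω ⟨h20, hω⟩
    have hC3 : Consts n l ω := hC2.of_agree hω (by decide)
    have h18' : ω.reg 18 = t := by rw [hω.1 18 (by decide), h18]
    have h19' : ω.reg 19 = t' := by rw [hω.1 19 (by decide), htx']
    rw [← hω.1 21 (by decide), ← hω.1 22 (by decide), ← hω.1 23 (by decide)] at hI'
    refine (Meets.of_wp ?_).mono (by decide) fun _ h => h
    rcases h20 with ⟨h20, hgood⟩ | ⟨h20, hbad⟩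
    · simp only [Prog.wp, Prog.seqs, Test.Holds, h20, hC3.reg3, Instr.apply, not_true,
        false_imp_iff, and_true, true_imp_iff]
      exact Or.inr ⟨by simp, t, ht, t', ht', by simp [h18'], by simp [h19'], hgood⟩
    · simp only [Prog.wp, Prog.seqs, Test.Holds, h20, hC3.reg3, zero_ne_one, not_false_eq_true,
        false_imp_iff, true_and, true_imp_iff]
      rcases hI' with ⟨h1, h2, h3⟩ | ⟨h1, h2⟩
      · refine Or.inl ⟨by simp [h1], h2, fun g hg => ?_⟩
        rcases Nat.lt_succ_iff_lt_or_eq.1 hg with h4 | rfl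
        · exact h3 g h4
        · exact hbad
      · exact Or.inr (by simpa [h1] using h2)
  · rintro υ hυ (⟨h1, h2, h3⟩ | ⟨h1, h2⟩)
    · refine Or.inl ⟨by simp [h1], fun f hf => ?_⟩
      rcases Nat.lt_succ_iff_lt_or_eq.1 hf with h4 | rfl
      · exact h2 f h4
      · exact h3
    · exact Or.inr (by simpa [h1] using h2)

/-- The constant registers `2`, `3`, `6`, `7` supply the four row numbers of the output. -/
theorem outputProg_meets (hC : Consts n l σ) {f g : ℕ} (hf : σ.reg 22 = f) (hg : σ.reg 23 = g) :
    Meets outputProg σ (30 * n + 3) fun τ => ∀ w < n, ∀ s : Fin 4,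
      τ.mem 6 s w = bitAdd (σ.mem 7 g (4 * w + s)) (σ.mem 7 f (4 * w + s)) := by
  refine (Meets.seq (T := 1) (T' := n * (28 + 2) + 2) (.instr ?_)).mono (by omega) fun _ h => h
  have hC0 := hC.setReg (x := 12) (by decide) 0
  refine Meets.for (fun t τ => τ.reg 12 = 4 * t ∧ ∀ w < t, ∀ s : Fin 4,
      τ.mem 6 s w = bitAdd (σ.mem 7 g (4 * w + s)) (σ.mem 7 f (4 * w + s))) hC0.reg0 (by decide)
    (by decide) (by simp [Instr.apply]) ?_ fun τ _ h => h.2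
  rintro t ht τ hτ htx ⟨h12, hI⟩
  have hC' : Consts n l τ := hC0.of_agree hτ (by decide)
  have h22 : τ.reg 22 = f := by rw [hτ.1 22 (by decide)]; simp [Instr.apply, hf]
  have h23 : τ.reg 23 = g := by rw [hτ.1 23 (by decide)]; simp [Instr.apply, hg]
  have hm : τ.mem 7 = σ.mem 7 := by rw [hτ.2 7 (by decide)]; simp [Instr.apply]
  refine (Meets.of_wp (Q := fun υ => υ.reg 12 = 4 * (t + 1) ∧ (∀ w < t, ∀ s,
    υ.mem 6 s w = τ.mem 6 s w) ∧ ∀ s : Fin 4, υ.mem 6 s t =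
      bitAdd (σ.mem 7 g (4 * t + s)) (σ.mem 7 f (4 * t + s))) ?_).mono (by decide) ?_
  · simp only [Prog.seqs, Prog.wp, Instr.apply]
    rw [Prog.wp_addBit (by simp [hC'.reg3]), Prog.wp_addBit (by simp [hC'.reg3]),
      Prog.wp_addBit (by simp [hC'.reg3]), Prog.wp_addBit (by simp [hC'.reg3])]
    refine ⟨by simp [h12]; omega, fun w hw s => ?_, ?_⟩
    · have : w ≠ t := by omega
      simp [htx, this]
    · simp [Fin.forall_fin_succ, hC'.reg2, hC'.reg3, hC'.reg6, hC'.reg7, h12, htx, h22, h23, hm]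
  · rintro υ ⟨h1, h2, h3⟩
    refine ⟨by simpa using h1, fun w hw s => ?_⟩
    rcases Nat.lt_succ_iff_lt_or_eq.1 hw with h4 | rfl
    · rw [State.setReg_mem, h2 w h4, hI w h4]
    · exact h3 s

end RAM

/-! ### Why sums of two generators suffice -/

section Search

/-- If the determinants are constant on the span of a family of quadruples that contains zero, and
the span contains a solution of (ii), then so does the set of the sums of two members. -/
theorem exists_add_satII {V : Type*} [Nonempty V] (k : ℕ → Quad V) {M z : ℕ} (hz : z < M)
    (hk : k z = 0)
    (hdet : ∀ x ∈ Submodule.span (ZMod 2) (k '' Set.Iio M), ∀ u v, x.det u = x.det v)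
    (hex : ∃ x ∈ Submodule.span (ZMod 2) (k '' Set.Iio M), x.SatII) :
    ∃ f < M, ∃ g < M, (k f + k g).SatII := by
  by_contra! hno
  obtain ⟨v⟩ := ‹Nonempty V›
  have hmem : ∀ {f}, f < M → k f ∈ Submodule.span (ZMod 2) (k '' Set.Iio M) := fun hf =>
    Submodule.subset_span ⟨_, hf, rfl⟩
  have h2 : ∀ f < M, ∀ g < M, (k f + k g).det v = 0 := by
    intro f hf g hg
    refine (ZMod.eq_zero_or_eq_one_of_two _).resolve_right fun h => hno f hf g hg ?_
    rw [Quad.satII_iff]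
    exact fun w => (hdet _ (Submodule.add_mem _ (hmem hf) (hmem hg)) w v).trans h
  -- The zero member makes each single generator a sum of two members.
  have h1 : ∀ f < M, (k f).det v = 0 := fun f hf => by
    simpa [hk] using h2 f hf z hz
  -- The determinant vanishes at `k f`, `k g` and their sum, hence so does the polar form;
  -- bilinearity then propagates both vanishings to the span.
  have hb : ∀ f < M, ∀ g < M, (k f).polar (k g) v = 0 := by
    intro f hf g hg
    simpa [Quad.det_add, h1 f hf, h1 g hg] using h2 f hf g hg
  have hzero : ∀ x : Quad V, (0 : Quad V).polar x v = 0 := fun x => by simp [Quad.polar]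
  have hsmul : ∀ (a : ZMod 2) (x y : Quad V), x.polar y v = 0 → (a • x).polar y v = 0 := by
    intro a x y h
    rcases ZMod.eq_zero_or_eq_one_of_two a with rfl | rfl
    · rw [zero_smul, hzero]
    · rwa [one_smul]
  have hb1 : ∀ x ∈ Submodule.span (ZMod 2) (k '' Set.Iio M), ∀ g < M, x.polar (k g) v = 0 := by
    intro x hx g hg
    induction hx using Submodule.span_induction with
    | mem x h => obtain ⟨f, hf, rfl⟩ := h; exact hb f hf g hg
    | zero => exact hzero _
    | add x y _ _ h h' => rw [Quad.polar_add_left, h, h', add_zero]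
    | smul a x _ h => exact hsmul a x _ h
  have hb2 : ∀ x ∈ Submodule.span (ZMod 2) (k '' Set.Iio M),
      ∀ y ∈ Submodule.span (ZMod 2) (k '' Set.Iio M), y.polar x v = 0 := by
    intro x hx y hy
    induction hy using Submodule.span_induction with
    | mem y h => obtain ⟨f, hf, rfl⟩ := h; rw [Quad.polar_comm]; exact hb1 x hx f hf
    | zero => exact hzero _
    | add x y _ _ h h' => rw [Quad.polar_add_left, h, h', add_zero]
    | smul a x _ h => exact hsmul a x _ h
  have hd : ∀ x ∈ Submodule.span (ZMod 2) (k '' Set.Iio M), x.det v = 0 := by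
    intro x hx
    induction hx using Submodule.span_induction with
    | mem x h => obtain ⟨f, hf, rfl⟩ := h; exact h1 f hf
    | zero => simp [Quad.det]
    | add x y hx hy h h' => rw [Quad.det_add, h, h', hb2 y hy x hx, add_zero, add_zero]
    | smul a x _ h =>
      rcases ZMod.eq_zero_or_eq_one_of_two a with rfl | rfl
      · simp [Quad.det]
      · rwa [one_smul]
  obtain ⟨x, hx, hII⟩ := hex
  have := (Quad.satII_iff x).1 hII v
  rw [hd x hx] at this
  exact zero_ne_one this

end Search

/-! ### Correctness and running time of the solver -/

namespace RAM

variable {n l : ℕ} {σ : State}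

/-- The quadruple whose entries are listed in `x`. -/
def unflat (n : ℕ) : (ℕ → ZMod 2) →ₗ[ZMod 2] Quad (Fin n) where
  toFun x s v := x (4 * v + s)
  map_add' _ _ := rfl
  map_smul' _ _ := rfl

theorem unflat_apply (x : ℕ → ZMod 2) (s : Fin 4) (v : Fin n) :
    unflat n x s v = x (4 * v + s) := rfl

theorem dot_eq (c k : ℕ → ZMod 2) :
    dot n c k = ∑ s, ∑ v, unflat n c s v * unflat n k s v := by
  simp only [unflat_apply, Finset.sum_comm (s := (Finset.univ : Finset (Fin 4)))]
  rw [dot, Fin.sum_univ_eq_sum_range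
    (fun v => ∑ s : Fin 4, c (4 * v + s) * k (4 * v + s)) n]
  induction n with
  | zero => simp
  | succ n ih =>
    rw [Finset.sum_range_succ, ← ih, show 4 * (n + 1) = 4 * n + 1 + 1 + 1 + 1 by omega]
    simp only [Finset.sum_range_succ, Fin.sum_univ_four]
    simp only [Fin.val_zero, Fin.val_one, Fin.val_two, add_assoc]
    rfl

/-- The linear form with the coefficients `c`. -/
def linearForm {V : Type*} [Fintype V] (c : Quad V) : Quad V →ₗ[ZMod 2] ZMod 2 where
  toFun x := ∑ s, ∑ v, c s v * x s v
  map_add' x y := by simp [mul_add, Finset.sum_add_distrib]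
  map_smul' a x := by simp [mul_left_comm _ a, ← Finset.mul_sum]

theorem satI_iff_coeffs (G G' : SimpleGraph (Fin n)) {g h : ℕ → ℕ → ZMod 2}
    (hg : ∀ i j, adjArray G i j = (g i j).val) (hh : ∀ i j, adjArray G' i j = (h i j).val)
    (x : Quad (Fin n)) :
    x.SatI G G' ↔ ∀ u < n, ∀ v < n,
      Quad.SatConstraint (unflat n (interleave (coeffs g h u v))) x := by
  classical
  have key : ∀ (G : SimpleGraph (Fin n)) (g : ℕ → ℕ → ZMod 2),
      (∀ i j, adjArray G i j = (g i j).val) → ∀ u v : Fin n,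
      g u v = if G.Adj u v then 1 else 0 := by
    intro G g hg u v
    have h1 := hg u v
    have h2 : (∃ u' v' : Fin n, (u' : ℕ) = u ∧ (v' : ℕ) = v ∧ G.Adj u' v') ↔ G.Adj u v := by
      constructor
      · rintro ⟨u', v', hu, hv, h⟩
        rwa [Fin.ext hu, Fin.ext hv] at h
      · exact fun h => ⟨u, v, rfl, rfl, h⟩
    rw [adjArray, if_congr h2 rfl rfl] at h1
    rcases ZMod.eq_zero_or_eq_one_of_two (g u v) with h0 | h0 <;> rw [h0] at h1 ⊢ <;>
      by_cases h3 : G.Adj u v <;> simp [h3, ZMod.val_one_two] at h1 ⊢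
  rw [Quad.satI_iff]
  have hfin : ∀ p : ℕ → ℕ → Prop, (∀ u < n, ∀ v < n, p u v) ↔ ∀ u v : Fin n, p u v := fun p =>
    ⟨fun h u v => h u u.2 v v.2, fun h u hu v hv => h ⟨u, hu⟩ ⟨v, hv⟩⟩
  rw [hfin]
  refine forall_congr' fun u => forall_congr' fun v => ?_
  unfold Quad.SatConstraint
  rw [Fin.sum_univ_four]
  simp only [unflat_apply, interleave_apply, coeffs, Matrix.cons_val, key G g hg, key G' h hh,
    Fin.val_inj]
  refine Eq.congr ?_ rfl
  rw [add_comm (∑ w, x 1 w * _), add_assoc _ (∑ w, x 3 w * _), add_comm (∑ w, x 3 w * _),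
    ← add_assoc]
  refine congr (congrArg _ (congr (congrArg _ (congr (congrArg _ ?_) ?_)) ?_)) ?_ <;>
    refine Finset.sum_congr rfl fun w _ => ?_ <;> split_ifs <;> simp_all

/-- The rows of the array `7` span the space of the quadruples with the property `p`, and the last
one is zero. -/
def Spans (n : ℕ) (p : Quad (Fin n) → Prop) (σ : State) : Prop :=
  ∃ F : ℕ → ℕ → ZMod 2, Rows n F σ ∧ unflat n (F (4 * n)) = 0 ∧
    ∀ x, x ∈ Submodule.span (ZMod 2) ((fun j => unflat n (F j)) '' Set.Iio (4 * n + 1)) ↔ p x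

theorem Spans.congr {p p' : Quad (Fin n) → Prop} (h : Spans n p σ) (hp : ∀ x, p x ↔ p' x) :
    Spans n p' σ := by
  obtain ⟨F, h1, h2, h3⟩ := h
  exact ⟨F, h1, h2, fun x => (h3 x).trans (hp x)⟩

theorem Spans.of_mem_eq {p : Quad (Fin n) → Prop} {τ : State} (h : Spans n p σ)
    (hm : τ.mem 7 = σ.mem 7) : Spans n p τ := by
  obtain ⟨F, h1, h2, h3⟩ := h
  exact ⟨F, fun j hj i hi => by rw [hm]; exact h1 j hj i hi, h2, h3⟩

theorem spans_of_rows (h : Rows n (fun j i => if j = i then 1 else 0) σ) :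
    Spans n (fun _ => True) σ := by
  refine ⟨_, h, ?_, fun x => iff_of_true ?_ trivial⟩
  -- The 1 of row `4n` sits in column `4n`, just beyond the entries that `unflat` reads.
  · ext s v
    simp only [unflat_apply, Pi.zero_apply]
    rw [if_neg (by omega)]
  · have hx : x = ∑ s, ∑ v, x s v • unflat n (fun i => if 4 * (v : ℕ) + (s : ℕ) = i then 1 else 0) := by
      ext s v
      simp only [Finset.sum_apply, Pi.smul_apply, unflat_apply, smul_eq_mul]
      rw [Finset.sum_eq_single s, Finset.sum_eq_single v]
      · simp
      · intro w _ hw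
        have : (w : ℕ) ≠ v := fun h => hw (Fin.ext h)
        rw [if_neg (by omega), mul_zero]
      · simp
      · intro t _ ht
        refine Finset.sum_eq_zero fun w _ => ?_
        have : (t : ℕ) ≠ s := fun h => ht (Fin.ext h)
        rw [if_neg (by omega), mul_zero]
      · simp
    rw [hx]
    exact Submodule.sum_mem _ fun s _ => Submodule.sum_mem _ fun v _ =>
      Submodule.smul_mem _ _ (Submodule.subset_span
        ⟨4 * v + s, by simp only [Set.mem_Iio]; omega, rfl⟩)

/-- Let `U` be the span and `φ x = x + c(x) s`. Then `φ` fixes `U ∩ ker c`. With a pivot, `s ∈ U`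
and `c(s) = 1`, so `φ` maps `U` into `ker c`; without one, `c` vanishes on `U`. Either way `φ(U) = U
∩ ker c`, and the zero row stays zero. -/
theorem reduceProg_spans (hC : Consts n l σ) {c : ℕ → ZMod 2} {p : Quad (Fin n) → Prop}
    (hc : ∀ i < 4 * n, σ.mem 8 0 i = (c i).val) (hp : Spans n p σ) :
    Meets reduceProg σ ((4 * n + 1) * (80 * n + 12) + 3)
      (Spans n fun x => p x ∧ Quad.SatConstraint (unflat n c) x) := by
  obtain ⟨F, hF, hF0, hspan⟩ := hp
  refine (reduceProg_meets hC hc hF).mono le_rfl ?_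
  rintro τ ⟨s, hR, hs⟩
  have hdot : ∀ j, dot n c (F j) = linearForm (unflat n c) (unflat n (F j)) := fun j => dot_eq _ _
  refine ⟨_, hR, ?_, fun x => ?_⟩
  · have h0 : dot n c (F (4 * n)) = 0 := by rw [hdot, hF0, map_zero]
    simpa only [h0, zero_mul, add_zero] using hF0
  · let φ : Quad (Fin n) →ₗ[ZMod 2] Quad (Fin n) :=
      LinearMap.id + (linearForm (unflat n c)).smulRight (unflat n s)
    have hφ : ∀ y, φ y = y + linearForm (unflat n c) y • unflat n s := fun y => rfl
    have himg : (fun j => unflat n fun i => F j i + dot n c (F j) * s i) '' Set.Iio (4 * n + 1)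
        = φ '' ((fun j => unflat n (F j)) '' Set.Iio (4 * n + 1)) := by
      rw [Set.image_image]
      refine Set.image_congr' fun j => ?_
      rw [hφ, ← hdot]
      rfl
    rw [himg, ← Submodule.map_span]
    change _ ↔ p x ∧ linearForm (unflat n c) x = 0
    rw [← hspan]
    constructor
    · rintro ⟨y, hy, rfl⟩
      rw [hφ]
      rcases hs with hs | ⟨j, hj, rfl, hs⟩
      · have hy0 : linearForm (unflat n c) y = 0 := by
          refine (LinearMap.mem_ker (f := linearForm (unflat n c))).1 (Submodule.span_le.2 ?_ hy)
          rintro _ ⟨j, hj, rfl⟩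
          exact (hdot j).symm.trans (hs j hj)
        rw [hy0, zero_smul, add_zero]
        exact ⟨hy, hy0⟩
      · rw [hdot] at hs
        refine ⟨Submodule.add_mem _ hy (Submodule.smul_mem _ _
          (Submodule.subset_span ⟨j, hj, rfl⟩)), ?_⟩
        rw [map_add, map_smul, hs, smul_eq_mul, mul_one]
        exact CharTwo.add_self_eq_zero _
    · rintro ⟨hx, hx0⟩
      exact ⟨x, hx, by rw [hφ, hx0, zero_smul, add_zero]⟩

/-- Imposes the equations (i). -/
def equationsProg : Prog := .for 8 0 (.for 9 0 (.seq equationProg reduceProg))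

/-- Imposes the linear constraints. -/
def constraintsProg : Prog := .for 10 1 (.seq constraintProg reduceProg)

theorem equationsProg_meets (hC : Consts n l σ) {g h : ℕ → ℕ → ZMod 2}
    (hg : ∀ u v, σ.mem 0 u v = (g u v).val) (hh : ∀ u v, σ.mem 1 u v = (h u v).val)
    (hp : Spans n (fun _ => True) σ) :
    Meets equationsProg σ
      (n * (n * (22 * n + 3 + ((4 * n + 1) * (80 * n + 12) + 3) + 2) + 2 + 2) + 2)
      (Spans n fun x => ∀ u < n, ∀ v < n,
        Quad.SatConstraint (unflat n (interleave (coeffs g h u v))) x) := by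
  refine Meets.for (fun t => Spans n fun x => ∀ u < t, ∀ v < n,
      Quad.SatConstraint (unflat n (interleave (coeffs g h u v))) x) hC.reg0 (by decide) (by decide)
    ((hp.of_mem_eq rfl).congr (by simp)) ?_ fun τ _ h => h
  intro t ht τ hτ htx hI
  have hC1 : Consts n l τ := hC.of_agree hτ (by decide)
  refine Meets.for (fun t' => Spans n fun x => (∀ u < t, ∀ v < n,
      Quad.SatConstraint (unflat n (interleave (coeffs g h u v))) x) ∧ ∀ v < t',
      Quad.SatConstraint (unflat n (interleave (coeffs g h t v))) x) hC1.reg0 (by decide)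
    (by decide) ((hI.of_mem_eq rfl).congr (by simp)) ?_ ?_
  · intro t' ht' υ hυ htx' hI'
    have hC2 : Consts n l υ := hC1.of_agree hυ (by decide)
    have hm0 : υ.mem 0 = σ.mem 0 := by rw [hυ.2 0 (by decide), hτ.2 0 (by decide)]
    have hm1 : υ.mem 1 = σ.mem 1 := by rw [hυ.2 1 (by decide), hτ.2 1 (by decide)]
    have h8 : υ.reg 8 = t := by rw [hυ.1 8 (by decide), htx]
    refine Meets.seq ((equationProg_meets hC2 h8 htx' (fun w => by rw [hm0, hg])
      (fun w => by rw [hm1, hh])).frame.mono le_rfl ?_)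
    rintro ω ⟨hc, hω⟩
    refine (reduceProg_spans (hC2.of_agree hω (by decide)) hc
      (hI'.of_mem_eq (hω.2 7 (by decide)))).mono le_rfl fun ξ hξ =>
        (hξ.of_mem_eq rfl).congr fun x => ?_
    rw [and_assoc]
    refine and_congr_right fun _ => ⟨?_, fun h => ⟨fun v hv => h v (by omega), h _ (by omega)⟩⟩
    rintro ⟨h1, h2⟩ v hv
    rcases Nat.lt_succ_iff_lt_or_eq.1 hv with h3 | rfl
    · exact h1 v h3
    · exact h2
  · intro υ _ h
    refine (h.of_mem_eq rfl).congr fun x => ⟨?_, fun h => ⟨fun u hu => h u (by omega), h _ (by omega)⟩⟩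
    rintro ⟨h1, h2⟩ u hu
    rcases Nat.lt_succ_iff_lt_or_eq.1 hu with h3 | rfl
    · exact h1 u h3
    · exact h2

theorem constraintsProg_meets (hC : Consts n l σ) {c : ℕ → Fin 4 → ℕ → ZMod 2}
    (h0 : ∀ e w, σ.mem 2 e w = (c e 0 w).val) (h1 : ∀ e w, σ.mem 3 e w = (c e 1 w).val)
    (h2 : ∀ e w, σ.mem 4 e w = (c e 2 w).val) (h3 : ∀ e w, σ.mem 5 e w = (c e 3 w).val)
    {p : Quad (Fin n) → Prop} (hp : Spans n p σ) :
    Meets constraintsProg σ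
      (l * (14 * n + 3 + ((4 * n + 1) * (80 * n + 12) + 3) + 2) + 2)
      (Spans n fun x => p x ∧ ∀ e < l, Quad.SatConstraint (unflat n (interleave (c e))) x) := by
  refine Meets.for (fun t => Spans n fun x => p x ∧ ∀ e < t,
      Quad.SatConstraint (unflat n (interleave (c e))) x) hC.reg1 (by decide) (by decide)
    ((hp.of_mem_eq rfl).congr (by simp)) ?_ fun τ _ h => h
  intro t ht τ hτ htx hI
  have hC1 : Consts n l τ := hC.of_agree hτ (by decide)
  have hm2 : τ.mem 2 = σ.mem 2 := hτ.2 2 (by decide)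
  have hm3 : τ.mem 3 = σ.mem 3 := hτ.2 3 (by decide)
  have hm4 : τ.mem 4 = σ.mem 4 := hτ.2 4 (by decide)
  have hm5 : τ.mem 5 = σ.mem 5 := hτ.2 5 (by decide)
  refine Meets.seq ((constraintProg_meets hC1 htx (c := c t) (fun w => by rw [hm2, h0])
    (fun w => by rw [hm3, h1]) (fun w => by rw [hm4, h2])
    (fun w => by rw [hm5, h3])).frame.mono le_rfl ?_)
  rintro ω ⟨hc, hω⟩
  refine (reduceProg_spans (hC1.of_agree hω (by decide)) hc
    (hI.of_mem_eq (hω.2 7 (by decide)))).mono le_rfl fun ξ hξ =>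
      (hξ.of_mem_eq rfl).congr fun x => ?_
  rw [and_assoc]
  refine and_congr_right fun _ => ⟨?_, fun h => ⟨fun v hv => h v (by omega), h _ (by omega)⟩⟩
  rintro ⟨h1, h2⟩ v hv
  rcases Nat.lt_succ_iff_lt_or_eq.1 hv with h3 | rfl
  · exact h1 v h3
  · exact h2

/-- Finds a solution of (i), (ii) and the constraints. -/
def solveProg : Prog :=
  .seq setupProg (.seq equationsProg (.seq constraintsProg (.seq searchProg
    (.seq outputProg (.instr (.copy 0 21))))))

theorem solveProg_meets (G G' : SimpleGraph (Fin n)) (hG : G.Connected) (L : Fin l → Quad (Fin n)) :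
    Meets solveProg (inputState G G' L) (5000 * ((n ^ 2 + l) * n ^ 2)) fun τ =>
      ((∃ x ∈ solutionSpace G G' (Set.range L), x.SatII) →
        ∃ x ∈ solutionSpace G G' (Set.range L), x.SatII ∧ AnnouncesSolution τ x) ∧
      ((¬ ∃ x ∈ solutionSpace G G' (Set.range L), x.SatII) → AnnouncesNone τ) := by
  have hbit : ∀ (H : SimpleGraph (Fin n)) i j, adjArray H i j = ((adjArray H i j : ℕ) : ZMod 2).val := by
    intro H i j
    unfold adjArray
    split_ifs <;> rfl
  set g : ℕ → ℕ → ZMod 2 := fun i j => (adjArray G i j : ℕ) with hg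
  set h : ℕ → ℕ → ZMod 2 := fun i j => (adjArray G' i j : ℕ) with hh
  let c : ℕ → Fin 4 → ℕ → ZMod 2 := fun e s w =>
    if h : e < l ∧ w < n then L ⟨e, h.1⟩ s ⟨w, h.2⟩ else 0
  have hc : ∀ e s w, constraintArray L s e w = (c e s w).val := by
    intro e s w
    simp only [constraintArray, c]
    split_ifs <;> rfl
  have hcL : ∀ e : Fin l, unflat n (interleave (c e)) = L e := by
    intro e
    ext s v
    rw [unflat_apply, interleave_apply]
    simp [c]
  have hsol : ∀ x, x ∈ solutionSpace G G' (Set.range L) ↔ (∀ u < n, ∀ v < n,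
      Quad.SatConstraint (unflat n (interleave (coeffs g h u v))) x) ∧
      ∀ e < l, Quad.SatConstraint (unflat n (interleave (c e))) x := by
    intro x
    rw [← satI_iff_coeffs G G' (hbit G) (hbit G')]
    change (x.SatI G G' ∧ _) ↔ _
    refine and_congr_right fun _ => ?_
    rw [Set.forall_mem_range]
    exact ⟨fun h e he => by simpa only [← hcL] using h ⟨e, he⟩, fun h e => by
      rw [← hcL]; exact h e e.2⟩
  have hn : Nonempty (Fin n) := hG.nonempty
  have hn0 : 0 < n := Fin.pos_iff_nonempty.2 hn
  -- Quadratic work for each of `n² + l` equations dominates the cubic search. Since `n > 0`, lower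
  -- powers and constants are absorbed; 5000 is a generous constant.
  have htime : (18 * n + 11) + ((n * (n * (22 * n + 3 + ((4 * n + 1) * (80 * n + 12) + 3) + 2)
      + 2 + 2) + 2) + ((l * (14 * n + 3 + ((4 * n + 1) * (80 * n + 12) + 3) + 2) + 2) +
      (((4 * n + 1) * ((4 * n + 1) * (37 * n + 10) + 4) + 3) + ((30 * n + 3) + 1))))
      ≤ 5000 * ((n ^ 2 + l) * n ^ 2) := by
    have a1 : n ≤ n ^ 2 := by nlinarith
    have a2 : n ^ 2 ≤ n ^ 3 := Nat.pow_le_pow_right hn0 (by decide)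
    have a3 : n ^ 3 ≤ n ^ 4 := Nat.pow_le_pow_right hn0 (by decide)
    have b1 : l ≤ l * n := Nat.le_mul_of_pos_right l hn0
    have b2 : l * n ≤ l * n ^ 2 := Nat.mul_le_mul_left l a1
    nlinarith
  refine Meets.mono (Meets.seq ((setupProg_meets rfl rfl fun _ _ => rfl).frame.mono le_rfl ?_))
    htime fun _ h => h
  rintro σ₁ ⟨⟨hC1, hR1⟩, hσ1⟩
  refine Meets.seq ((equationsProg_meets hC1 (g := g) (h := h) (fun u v => ?_) (fun u v => ?_)
    (spans_of_rows hR1)).frame.mono le_rfl ?_)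
  · rw [hσ1.2 0 (by decide)]; exact hbit G u v
  · rw [hσ1.2 1 (by decide)]; exact hbit G' u v
  rintro σ₂ ⟨hS2, hσ2⟩
  have hC2 : Consts n l σ₂ := hC1.of_agree hσ2 (by decide)
  refine Meets.seq ((constraintsProg_meets hC2 (c := c) (fun e w => ?_) (fun e w => ?_)
    (fun e w => ?_) (fun e w => ?_) hS2).frame.mono le_rfl ?_)
  · rw [hσ2.2 2 (by decide), hσ1.2 2 (by decide)]; exact hc e 0 w
  · rw [hσ2.2 3 (by decide), hσ1.2 3 (by decide)]; exact hc e 1 w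
  · rw [hσ2.2 4 (by decide), hσ1.2 4 (by decide)]; exact hc e 2 w
  · rw [hσ2.2 5 (by decide), hσ1.2 5 (by decide)]; exact hc e 3 w
  rintro σ₃ ⟨hS3, hσ3⟩
  have hC3 : Consts n l σ₃ := hC2.of_agree hσ3 (by decide)
  obtain ⟨F, hF, hF0, hspan⟩ := hS3.congr fun x => (hsol x).symm
  refine Meets.seq ((searchProg_meets hC3 hF).frame.mono le_rfl ?_)
  rintro σ₄ ⟨hfound, hσ4⟩
  have hC4 : Consts n l σ₄ := hC3.of_agree hσ4 (by decide)
  -- The output is written even after a failed search; in that case only register `0` is read.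
  refine Meets.seq ((outputProg_meets hC4 rfl rfl).frame.mono le_rfl ?_)
  rintro σ₅ ⟨hout, hσ5⟩
  have h21 : σ₅.reg 21 = σ₄.reg 21 := hσ5.1 21 (by decide)
  have hgood : ∀ f g', (∀ w < n, det (F f + F g') w = 1) ↔
      (unflat n (F f) + unflat n (F g')).SatII := by
    intro f g'
    rw [Quad.satII_iff, ← map_add]
    exact ⟨fun h v => h v v.2, fun h w hw => h ⟨w, hw⟩⟩
  have hmem : ∀ {f}, f < 4 * n + 1 → unflat n (F f) ∈ solutionSpace G G' (Set.range L) :=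
    fun hf => (hspan _).1 (Submodule.subset_span ⟨_, hf, rfl⟩)
  -- The verdict reaches register `0` only now, because that register held `n`, the bound of the
  -- loops.
  refine .instr ?_
  rcases hfound with ⟨hf, hnone⟩ | ⟨hf, f, hf', g', hg', h22, h23, hII⟩
  · refine ⟨fun ⟨x, hx, hxII⟩ => ?_, fun _ => ?_⟩
    · obtain ⟨f, hf, g', hg', hfg⟩ := exists_add_satII (fun j => unflat n (F j))
        (Nat.lt_succ_self (4 * n)) hF0
        (fun x hx u v => Quad.SatI.det_eq hG ((hspan x).1 hx).1 u v) ⟨x, (hspan x).2 hx, hxII⟩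
      exact absurd ((hgood f g').2 hfg) (hnone f hf g' hg')
    · simp [AnnouncesNone, Instr.apply, h21, hf]
  · rw [hgood] at hII
    have hx := Submodule.add_mem _ (hmem hf') (hmem hg')
    refine ⟨fun _ => ⟨_, hx, hII, ?_, fun s v => ?_⟩, fun hno => absurd ⟨_, hx, hII⟩ hno⟩
    · simp [Instr.apply, h21, hf]
    · have hm7 : σ₄.mem 7 = σ₃.mem 7 := hσ4.2 7 (by decide)
      rw [Instr.apply, State.setReg_mem, hout v v.2 s, h22, h23, hm7,
        hF _ hf' _ (by omega), hF _ hg' _ (by omega), bitAdd_val]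
      rfl

end RAM

/-! ### The three statements together -/

theorem mainTheorem8 :
    -- The dichotomy for the solutions of (i), (ii) and `L`.
    (∀ (V : Type*) [Fintype V] (G G' : SimpleGraph V),
      G.Connected → G'.Connected → HasEvenDegreeVertex G → HasEvenDegreeVertex G' →
      ∀ L : Set (Quad V),
        Module.finrank (ZMod 2) (solutionSpace G G' L) ≤ 4 ∨
        {x : solutionSpace G G' L | (x : Quad V).SatII} = ∅ ∨
        ∃ E : AffineSubspace (ZMod 2) (solutionSpace G G' L),
          (E : Set (solutionSpace G G' L)) = {x : solutionSpace G G' L | (x : Quad V).SatII} ∧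
          Module.finrank (ZMod 2) (solutionSpace G G' L ⧸ E.direction) ≤ 2) ∧
    -- Solutions of (i) and (ii) are what LC-equivalence amounts to.
    (∀ (V : Type*) [Fintype V] (G G' : SimpleGraph V),
      LCEquivalent G G' ↔ ∃ A B C D : Set V, EquationI G G' A B C D ∧ EquationII A B C D) ∧
    -- One program finds a solution of (i), (ii) and `L`, or announces that there is none.
    (∃ (P : RAM.Prog) (K : ℕ), ∀ (n l : ℕ) (G G' : SimpleGraph (Fin n)),
      G.Connected → G'.Connected → HasEvenDegreeVertex G → HasEvenDegreeVertex G' →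
      ∀ L : Fin l → Quad (Fin n),
        ∃ (T : ℕ) (τ : RAM.State), RAM.Runs P (inputState G G' L) T τ ∧
          T ≤ K * ((n ^ 2 + l) * n ^ 2) ∧
          ((∃ x ∈ solutionSpace G G' (Set.range L), x.SatII) →
            ∃ x ∈ solutionSpace G G' (Set.range L), x.SatII ∧ AnnouncesSolution τ x) ∧
          ((¬ ∃ x ∈ solutionSpace G G' (Set.range L), x.SatII) → AnnouncesNone τ)) := by
  -- The empty-or-affine alternative holds in every dimension.
  refine ⟨fun V _ G G' hG _ he _ L => Or.inr (solutionSpace_dichotomy G G' hG he L),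
    fun V _ G G' => lcEquivalent_iff G G', RAM.solveProg, 5000, ?_⟩
  intro n l G G' hG _ _ _ L
  exact RAM.solveProg_meets G G' hG L
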